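/- For $n\ge 0$, $p\in(0,1/2]$ with $k=pn$ an integer, consider three probability measures on $\mathbb R^n$: $\mu_p$, the product of $n$ Bernoulli($p$) distributions on $\{0,1\}$; $\mathcal G_p$, the product of $n$ normal distributions with mean $p$ and variance $p(1-p)$; and $\nu_{pn}$, the uniform distribution on the slice $\binom{[n]}{pn}=\{x\in\{0,1\}^n:\sum_i x_i=pn\}$. Write $\|f\|_\pi=(\mathbb E_\pi[f^2])^{1/2}$. A polynomial $f\in\mathbb R[x_1,\dots,x_n]$ is multilinear if $\partial^2 f/\partial x_i^2=0$ for all $i$, and harmonic if $\sum_i\partial f/\partial x_i=0$. For a multilinear $f$ and $\pi\in\{\mu_p,\mathcal G_p\}$ put $\omega_S=\prod_{i\in S}\frac{x_i-p}{\sqrt{p(1-p)}}$, $\hat f(S)=\mathbb E_{\mu_p}[f\omega_S]$, $f^{=\ell}=\sum_{|S|=\ell}\hat f(S)\omega_S$, and $\mathbb S_\rho[f]_\pi=\big\langle f,\sum_{i=0}^{\deg f}\rho^i f^{=i}\big\rangle_\pi$. For a harmonic multilinear $g$ on the slice let $g^{=\ell}$ be the homogeneous part of $g$ of degree $\ell$,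 and $\mathbb S_\rho[g]_{\nu_{pn}}=\big\langle g,\sum_{i=0}^{\deg g}\rho^i g^{=i}\big\rangle_{\nu_{pn}}$ (with $\rho^0=1$). **Statement.** There are functions $A,N:(0,1/2]\to\mathbb R$, continuous in $p$, such that the following holds for all $p\in(0,1/2]$ and all integers $n\ge N(p)$ and $d\ge 0$ with $pn$ an integer and $d\le pn$ (so $d\le pn\le n/2$). Let $f\in\mathbb R[x_1,\dots,x_n]$ be a multilinear polynomial depending on at most $d$ variables with $\|f\|_{\mu_p}\le 1$ (equivalently $\|f\|_{\mathcal G_p}\le 1$). Then there is a unique harmonic multilinear polynomial $\tilde f$ of degree at most $\min(pn,(1-p)n)$ that agrees with $f$ on $\binom{[n]}{pn}$ (the harmonic projection of $f$), and with $\varepsilon=A(p)\,\frac{d\,2^{d/2}}{\sqrt n}$ (read as $0$ when $n=0$), for each $\pi\in\{\mu_p,\mathcal G_p\}$: 1. $\big|\mathbb E_\pi[f]-\mathbb E_{\nu_{pn}}[\tilde f]\big|\le\varepsilon$; 2. $\big|\|\tilde f\|_{\nu_{pn}}-\|f\|_\pi\big|\le\varepsilon$; 3. $\big|\mathbb V[\tilde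 f]_{\nu_{pn}}-\mathbb V[f]_\pi\big|\le\varepsilon$; 4. for all $\rho\in[0,1]$, $\big|\mathbb S_\rho[\tilde f]_{\nu_{pn}}-\mathbb S_\rho[f]_\pi\big|\le\varepsilon$; 5. for all integers $0\le\ell\le d$, $\big|\|\tilde f^{=\ell}\|_{\nu_{pn}}-\|f^{=\ell}\|_\pi\big|\le\varepsilon$. -/

import Mathlib

namespace HarmonicSlice

open MvPolynomial MeasureTheory

noncomputable section

/-- The slice `([n] choose k)`: all 0/1 vectors in `ℝⁿ` with coordinate sum `k`. -/
def slice (n k : ℕ) : Set (Fin n → ℝ) :=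
  {x | (∀ i, x i = 0 ∨ x i = 1) ∧ ∑ i, x i = k}

/-- `ν_k`: the uniform distribution on the slice. -/
def sliceMeasure (n k : ℕ) : Measure (Fin n → ℝ) :=
  ProbabilityTheory.uniformOn (slice n k)

/-- `μ_p`: the product of `n` copies of the Bernoulli distribution on `{0, 1}` with mean `p`. -/
def cubeMeasure (n : ℕ) (p : ℝ) : Measure (Fin n → ℝ) :=
  Measure.pi fun _ : Fin n =>
    ENNReal.ofReal (1 - p) • Measure.dirac (0 : ℝ) + ENNReal.ofReal p • Measure.dirac (1 : ℝ)

/-- `𝒢_p`: the product of `n` copies of the normal distribution with mean `p` and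
variance `p (1 - p)`. -/
def gaussMeasure (n : ℕ) (p : ℝ) : Measure (Fin n → ℝ) :=
  Measure.pi fun _ : Fin n => ProbabilityTheory.gaussianReal p (p * (1 - p)).toNNReal

/-- `E_π[f]`. -/
def expect {n : ℕ} (π : Measure (Fin n → ℝ)) (f : MvPolynomial (Fin n) ℝ) : ℝ :=
  ∫ x, eval x f ∂π

/-- `‖f‖_π`, the L2 norm. -/
def l2norm {n : ℕ} (π : Measure (Fin n → ℝ)) (f : MvPolynomial (Fin n) ℝ) : ℝ :=
  Real.sqrt (expect π (f ^ 2))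

/-- `V[f]_π`. -/
def var {n : ℕ} (π : Measure (Fin n → ℝ)) (f : MvPolynomial (Fin n) ℝ) : ℝ :=
  ProbabilityTheory.variance (fun x => eval x f) π

def IsMultilinear {n : ℕ} (f : MvPolynomial (Fin n) ℝ) : Prop :=
  ∀ i, pderiv i (pderiv i f) = 0

def IsHarmonic {n : ℕ} (f : MvPolynomial (Fin n) ℝ) : Prop :=
  ∑ i, pderiv i f = 0

/-- `g` is the harmonic projection of `f` with respect to the slice `([n] choose k)`: the harmonic
multilinear polynomial of degree at most `min k (n - k)` that agrees with `f` on the slice. -/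
structure IsHarmonicProjection {n : ℕ} (k : ℕ) (f g : MvPolynomial (Fin n) ℝ) : Prop where
  multilinear : IsMultilinear g
  harmonic : IsHarmonic g
  degree_le : g.totalDegree ≤ min k (n - k)
  agrees : ∀ x ∈ slice n k, eval x g = eval x f

/-- The Fourier character `ω_S = ∏_{i ∈ S} (x_i - p) / √(p (1 - p))`. -/
def character {n : ℕ} (p : ℝ) (S : Finset (Fin n)) : MvPolynomial (Fin n) ℝ :=
  ∏ i ∈ S, C (1 / Real.sqrt (p * (1 - p))) * (X i - C p)

/-- The Fourier coefficient of `f` at `S` with respect to `μ_p`. -/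
def fourierCoeff {n : ℕ} (p : ℝ) (f : MvPolynomial (Fin n) ℝ) (S : Finset (Fin n)) : ℝ :=
  expect (cubeMeasure n p) (f * character p S)

/-- The level-`l` part `f^{=l} = ∑_{|S| = l} f̂(S) ω_S` of a multilinear polynomial `f`, viewed as a
function on the cube or on Gaussian space. -/
def levelPart {n : ℕ} (p : ℝ) (l : ℕ) (f : MvPolynomial (Fin n) ℝ) : MvPolynomial (Fin n) ℝ :=
  ∑ S ∈ Finset.powersetCard l (Finset.univ : Finset (Fin n)),
    C (fourierCoeff p f S) * character p S

/-- The noise operator `T_ρ f = ∑_{i ≤ deg f} ρ^i f^{=i}` on the cube; on multilinear polynomials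
it is also the Ornstein-Uhlenbeck operator `U_ρ` on Gaussian space. -/
def noiseOp {n : ℕ} (p ρ : ℝ) (f : MvPolynomial (Fin n) ℝ) : MvPolynomial (Fin n) ℝ :=
  ∑ i ∈ Finset.range (f.totalDegree + 1), C (ρ ^ i) * levelPart p i f

/-- The noise stability `⟨f, T_ρ f⟩_π` for `π` either `μ_p` or `𝒢_p`. -/
def noiseStab {n : ℕ} (π : Measure (Fin n → ℝ)) (p ρ : ℝ) (f : MvPolynomial (Fin n) ℝ) : ℝ :=
  expect π (f * noiseOp p ρ f)

/-- The same noise operator `∑_i ρ^i g^{=i}` for a harmonic multilinear polynomial `g` on a slice,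
where `g^{=i}` is the homogeneous part of degree `i`. -/
def sliceNoiseOp {n : ℕ} (ρ : ℝ) (g : MvPolynomial (Fin n) ℝ) : MvPolynomial (Fin n) ℝ :=
  ∑ i ∈ Finset.range (g.totalDegree + 1), C (ρ ^ i) * homogeneousComponent i g

/-- The noise stability `⟨g, T_ρ g⟩` with respect to `ν_k`, for harmonic multilinear `g`. -/
def sliceNoiseStab {n : ℕ} (k : ℕ) (ρ : ℝ) (g : MvPolynomial (Fin n) ℝ) : ℝ :=
  expect (sliceMeasure n k) (g * sliceNoiseOp ρ g)

/-- The error term `d 2^{d/2} / √n`. -/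
def errorTerm (d n : ℕ) : ℝ := (d : ℝ) * (2 : ℝ) ^ ((d : ℝ) / 2) / Real.sqrt n

end

end HarmonicSlice

/-!
Write `q = 1 - p`, `w_i = (x_i - p) / √(p q)`, `k = p n` and `η = d 2^{d/2} / √k`, which is the
error term divided by `√p`. A multilinear `f` is `∑_S b_S ω_S` with all `S` inside the set `D` of
at most `d` variables of `f`. Since the characters are orthonormal both on the cube and on Gaussian
space, everything the theorem compares with is an expression in the `b_S`; the two cases of `π` are
the same (`IsNormalisedBy`).

*Few coordinates.* The law of `t` coordinates on the slice is sampling without replacement, so for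
`t² ≤ k` its density with respect to the cube is `1 + O(t² / k)` (`abs_wsum_slice_sub_cube_le`).
Hence means and squared norms of `f` on the slice and on the cube differ by `O(d² / k)`.

*Harmonic polynomials.* For homogeneous harmonic `h` of degree `i` the sum of the coefficients over
all `S ⊇ A` vanishes when `|A| < i`. It follows that on the slice `h` is orthogonal to monomials of
lower degree, and that its inner product with `x_T`, `|T| = i`, is a positive multiple of the
coefficient at `T` (`HarmCoeff.wsum_ev_mul_monomial`, `splitProb_pos`). So the harmonic projection
is unique, a dimension count gives its existence (`existsUnique_isHarmonicProjection`), and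
multiplying the homogeneous parts of a harmonic polynomial by numbers in `[0, 1]` does not increase
its norm (`HarmCoeff.wsum_ev_levelMul_sq_le`).

*An explicit harmonic polynomial close to `f`.* Choose more than `k / d` disjoint copies of `D` in
the complement of `D`, substitute `w_i - w_{τ i}` for `w_i`, where `τ i` is the partner of `i` in
the copy, and average over the copies. The result `h` (`swapAvg`) is harmonic, since differences
`x_i - x_j` are. On the cube the changes made by different copies are orthogonal, and each has
squared norm at most `2^d`. A product of two changes depends on at most `3 d` coordinates, so the
first step gives `‖h - f‖² = O(d² 2^d / k)` on the slice
(`IsSwapFamily.wsum_sliceW_avg_sq_le`).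

*Conclusion.* Let `g` be the harmonic projection of `f`, and let `M` multiply the level `i` part by
`c_i ∈ [0, 1]`. On the slice `‖M g - M h‖ ≤ ‖g - h‖ = ‖f - h‖ = O(η)`, while `M h` is the polynomial
built from `M f`, so it is within `O(η)` of `M f`, whose norm is within `O(η)` of its norm on the
cube. The norm of `f`, the noise stability and the norm of a level are the cases `c_i = 1`,
`c_i = ρ^{i/2}` and `c_i = 1_{i = l}`. If `9 d² > k`, then `1 ≤ 3 η`, and it suffices that
the density of few coordinates is at most `2 + d 2^{d/2} / √n`
(`pow_div_descFactorial_le_two_add_errorTerm`).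
-/

open Finset

namespace HarmonicSlice

/-! ### Sums over subsets, and the slice compared with the cube on few coordinates -/

/-- The subsets with prescribed trace `B` on `T` are the sets `B ∪ C` with `C` disjoint from `T`. -/
theorem sum_filter_inter_eq {n : ℕ} {T B : Finset (Fin n)} (hB : B ⊆ T)
    (w : Finset (Fin n) → ℝ) :
    ∑ A with A ∩ T = B, w A = ∑ C ∈ (Tᶜ).powerset, w (B ∪ C) := by
  refine Finset.sum_nbij' (fun A => A \ T) (fun C => B ∪ C) ?_ ?_ ?_ ?_ ?_
  · intro A _
    simp only [mem_powerset]
    intro i; simp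
  · intro C hC
    simp only [mem_powerset] at hC
    simp only [mem_filter, mem_univ, true_and]
    ext i
    have h1 := @hB i
    have h2 := @hC i
    simp only [mem_inter, mem_union, mem_compl] at h2 ⊢
    tauto
  · intro A hA
    simp only [mem_filter, mem_univ, true_and] at hA
    subst hA
    ext i; simp only [mem_union, mem_inter, mem_sdiff]; tauto
  · intro C hC
    simp only [mem_powerset] at hC
    ext i
    have h1 := @hB i
    have h2 := @hC i
    simp only [mem_sdiff, mem_union, mem_compl] at h2 ⊢
    tauto
  · intro A hA
    simp only [mem_filter, mem_univ, true_and] at hA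
    subst hA
    congr 1
    ext i; simp only [mem_union, mem_inter, mem_sdiff]; tauto

noncomputable section

/-- The weighted sum `∑_A w(A) F(A)` over all subsets `A` of `[n]`, a subset standing for its
indicator vector. For `w = sliceW n k` and `w = cubeW p` it is an expectation. -/
def wsum {n : ℕ} (w F : Finset (Fin n) → ℝ) : ℝ := ∑ A, w A * F A

/-- The weights of the uniform distribution on the `k`-element subsets of `[n]`. -/
def sliceW (n k : ℕ) (A : Finset (Fin n)) : ℝ := if #A = k then ((n.choose k : ℕ) : ℝ)⁻¹ else 0

/-- The weights of the `p`-biased distribution on the subsets of `[n]`. -/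
def cubeW {n : ℕ} (p : ℝ) (A : Finset (Fin n)) : ℝ := p ^ #A * (1 - p) ^ #Aᶜ

end

section wsum
variable {n : ℕ} {w : Finset (Fin n) → ℝ}

theorem sliceW_nonneg {n k : ℕ} (A : Finset (Fin n)) : 0 ≤ sliceW n k A := by
  unfold sliceW; split_ifs <;> positivity

theorem cubeW_nonneg {n : ℕ} {p : ℝ} (h0 : 0 ≤ p) (h1 : p ≤ 1) (A : Finset (Fin n)) :
    0 ≤ cubeW p A := by
  unfold cubeW
  have : 0 ≤ 1 - p := by linarith
  positivity

theorem wsum_add (F G : Finset (Fin n) → ℝ) :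
    wsum w (fun A => F A + G A) = wsum w F + wsum w G := by
  simp [wsum, mul_add, sum_add_distrib]

theorem wsum_sub (F G : Finset (Fin n) → ℝ) :
    wsum w (fun A => F A - G A) = wsum w F - wsum w G := by
  simp [wsum, mul_sub, sum_sub_distrib]

theorem wsum_mul_left (c : ℝ) (F : Finset (Fin n) → ℝ) :
    wsum w (fun A => c * F A) = c * wsum w F := by
  simp only [wsum, mul_sum]; exact sum_congr rfl fun A _ => by ring

theorem wsum_sum {ι : Type*} (I : Finset ι) (F : ι → Finset (Fin n) → ℝ) :
    wsum w (fun A => ∑ i ∈ I, F i A) = ∑ i ∈ I, wsum w (F i) := by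
  simp only [wsum, mul_sum]; exact sum_comm

theorem wsum_mono (hw : ∀ A, 0 ≤ w A) {F G : Finset (Fin n) → ℝ} (h : ∀ A, F A ≤ G A) :
    wsum w F ≤ wsum w G :=
  sum_le_sum fun A _ => mul_le_mul_of_nonneg_left (h A) (hw A)

theorem wsum_nonneg (hw : ∀ A, 0 ≤ w A) {F : Finset (Fin n) → ℝ} (h : ∀ A, 0 ≤ F A) :
    0 ≤ wsum w F :=
  sum_nonneg fun A _ => mul_nonneg (hw A) (h A)

theorem wsum_mul_sq_le (hw : ∀ A, 0 ≤ w A) (F G : Finset (Fin n) → ℝ) :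
    (wsum w fun A => F A * G A) ^ 2 ≤ (wsum w fun A => F A ^ 2) * wsum w fun A => G A ^ 2 := by
  have h := sum_mul_sq_le_sq_mul_sq univ (fun A => √(w A) * F A) (fun A => √(w A) * G A)
  have e : ∀ A, √(w A) * √(w A) = w A := fun A => Real.mul_self_sqrt (hw A)
  have h1 : ∑ A, √(w A) * F A * (√(w A) * G A) = wsum w fun A => F A * G A :=
    sum_congr rfl fun A _ => by
      linear_combination F A * G A * e A
  have h2 : ∀ F : Finset (Fin n) → ℝ, ∑ A, (√(w A) * F A) ^ 2 = wsum w fun A => F A ^ 2 :=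
    fun F => sum_congr rfl fun A _ => by rw [mul_pow, sq (√(w A)), e A]
  rwa [h1, h2, h2] at h

theorem sqrt_wsum_add_le (hw : ∀ A, 0 ≤ w A) (F G : Finset (Fin n) → ℝ) :
    √(wsum w fun A => (F A + G A) ^ 2) ≤
      √(wsum w fun A => F A ^ 2) + √(wsum w fun A => G A ^ 2) := by
  have hF := wsum_nonneg hw (fun A => sq_nonneg (F A))
  have hG := wsum_nonneg hw (fun A => sq_nonneg (G A))
  have key : (wsum w fun A => F A * G A) ≤
      √(wsum w fun A => F A ^ 2) * √(wsum w fun A => G A ^ 2) := by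
    rw [← Real.sqrt_mul hF]
    exact Real.le_sqrt_of_sq_le (wsum_mul_sq_le hw F G)
  have e : (wsum w fun A => (F A + G A) ^ 2) = (wsum w fun A => F A ^ 2) +
      2 * (wsum w fun A => F A * G A) + wsum w fun A => G A ^ 2 := by
    rw [← wsum_mul_left, ← wsum_add, ← wsum_add]
    congr 1; funext A; ring
  refine Real.sqrt_le_iff.mpr ⟨by positivity, ?_⟩
  rw [e]
  nlinarith [Real.sq_sqrt hF, Real.sq_sqrt hG]

/-- The reverse triangle inequality for the weighted `L²` norm. -/
theorem abs_sqrt_wsum_sub_le (hw : ∀ A, 0 ≤ w A) (F G : Finset (Fin n) → ℝ) :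
    |√(wsum w fun A => F A ^ 2) - √(wsum w fun A => G A ^ 2)| ≤
      √(wsum w fun A => (F A - G A) ^ 2) := by
  have h1 := sqrt_wsum_add_le hw (fun A => F A - G A) G
  have h2 := sqrt_wsum_add_le hw (fun A => G A - F A) F
  simp only [sub_add_cancel] at h1 h2
  have h3 : (wsum w fun A => (G A - F A) ^ 2) = wsum w fun A => (F A - G A) ^ 2 := by
    congr 1; funext A; ring
  rw [h3] at h2
  rw [abs_le]; constructor <;> linarith

end wsum

/-- The marginal on `T` of the biased distribution on the cube. -/
theorem sum_cubeW_fiber {n : ℕ} (p : ℝ) {T B : Finset (Fin n)} (hB : B ⊆ T) :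
    ∑ A with A ∩ T = B, cubeW p A = p ^ #B * (1 - p) ^ #(T \ B) := by
  rw [sum_filter_inter_eq hB]
  have : ∀ C ∈ (Tᶜ).powerset, cubeW p (B ∪ C) =
      p ^ #B * (1 - p) ^ #(T \ B) * (p ^ #C * (1 - p) ^ (#Tᶜ - #C)) := by
    intro C hC
    rw [mem_powerset] at hC
    have hd : Disjoint B C :=
      disjoint_of_subset_left hB (disjoint_of_subset_right hC disjoint_compl_right)
    have hc : (B ∪ C)ᶜ = (T \ B) ∪ (Tᶜ \ C) := by
      ext i
      have h1 := @hB i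
      have h2 := @hC i
      simp only [mem_sdiff, mem_union, mem_compl] at h2 ⊢
      tauto
    have hd2 : Disjoint (T \ B) (Tᶜ \ C) :=
      disjoint_of_subset_left sdiff_subset
        (disjoint_of_subset_right sdiff_subset disjoint_compl_right)
    rw [cubeW, hc, card_union_of_disjoint hd, card_union_of_disjoint hd2,
      card_sdiff_of_subset hC]
    ring
  rw [sum_congr rfl this, ← mul_sum, sum_pow_mul_eq_add_pow]
  simp

/-- The marginal on `T` of the uniform distribution on the slice. -/
theorem sum_sliceW_fiber {n : ℕ} (k : ℕ) {T B : Finset (Fin n)} (hB : B ⊆ T) :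
    ∑ A with A ∩ T = B, sliceW n k A =
      if #B ≤ k then ((n - #T).choose (k - #B) : ℝ) / (n.choose k : ℝ) else 0 := by
  rw [sum_filter_inter_eq hB]
  have : ∀ C ∈ (Tᶜ).powerset, sliceW n k (B ∪ C) =
      if #B + #C = k then ((n.choose k : ℕ) : ℝ)⁻¹ else 0 := by
    intro C hC
    rw [mem_powerset] at hC
    have hd : Disjoint B C :=
      disjoint_of_subset_left hB (disjoint_of_subset_right hC disjoint_compl_right)
    rw [sliceW, card_union_of_disjoint hd]
  rw [sum_congr rfl this, ← sum_filter, sum_const, nsmul_eq_mul]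
  split_ifs with h
  · have e : {C ∈ (Tᶜ).powerset | #B + #C = k} = powersetCard (k - #B) Tᶜ := by
      ext C; simp only [mem_filter, mem_powerset, mem_powersetCard]
      refine and_congr_right fun _ => by omega
    rw [e, card_powersetCard, card_compl, Fintype.card_fin, div_eq_mul_inv]
  · rw [filter_false_of_mem, card_empty]
    · simp
    · intro C _; omega

theorem choose_sub_mul_descFactorial {n k j l : ℕ} (hj : j ≤ k) (hl : k + l ≤ n) :
    (n - (j + l)).choose (k - j) * n.descFactorial (j + l) =
      n.choose k * (k.descFactorial j * (n - k).descFactorial l) := by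
  have h1 := Nat.choose_mul_factorial_mul_factorial (n := n - (j + l)) (k := k - j) (by omega)
  have h2 := Nat.choose_mul_factorial_mul_factorial (n := n) (k := k) (by omega)
  have h3 := Nat.factorial_mul_descFactorial (n := n) (k := j + l) (by omega)
  have h4 := Nat.factorial_mul_descFactorial (n := k) (k := j) hj
  have h5 := Nat.factorial_mul_descFactorial (n := n - k) (k := l) (by omega)
  have e : n - (j + l) - (k - j) = n - k - l := by omega
  rw [e] at h1
  have hpos : 0 < (k - j).factorial * (n - k - l).factorial := by positivity
  refine Nat.eq_of_mul_eq_mul_left hpos ?_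
  calc _ = ((n - (j + l)).choose (k - j) * (k - j).factorial * (n - k - l).factorial)
            * n.descFactorial (j + l) := by ring
    _ = n.factorial := by rw [h1, h3]
    _ = n.choose k * ((k - j).factorial * k.descFactorial j) *
          ((n - k - l).factorial * (n - k).descFactorial l) := by rw [h4, h5, h2]
    _ = _ := by ring

/-- The marginal of the slice in the form of sampling without replacement, which compares directly
with the product form of the cube. -/
theorem sum_sliceW_fiber_eq_descFactorial {n k : ℕ} {T B : Finset (Fin n)} (hB : B ⊆ T)
    (hT : #T ≤ k) (hk : 2 * k ≤ n) :
    ∑ A with A ∩ T = B, sliceW n k A =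
      (k.descFactorial #B * (n - k).descFactorial #(T \ B) : ℝ) / n.descFactorial #T := by
  have hc := card_le_card hB
  have hs := card_sdiff_add_card_eq_card hB
  rw [sum_sliceW_fiber k hB, if_pos (by omega)]
  have h := choose_sub_mul_descFactorial (n := n) (k := k) (j := #B) (l := #(T \ B))
    (by omega) (by omega)
  rw [show #B + #(T \ B) = #T by omega] at h
  have h1 : (0 : ℝ) < n.choose k := by exact_mod_cast Nat.choose_pos (by omega)
  have h2 : (0 : ℝ) < n.descFactorial #T := by
    exact_mod_cast Nat.pos_of_ne_zero (by rw [Ne, Nat.descFactorial_eq_zero_iff_lt]; omega)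
  rw [div_eq_div_iff h1.ne' h2.ne']
  have h' : ((n - #T).choose (k - #B) : ℝ) * n.descFactorial #T =
      n.choose k * (k.descFactorial #B * (n - k).descFactorial #(T \ B)) := by exact_mod_cast h
  rw [h']; ring

theorem descFactorial_le_pow_real (m j : ℕ) : (m.descFactorial j : ℝ) ≤ (m : ℝ) ^ j := by
  exact_mod_cast Nat.descFactorial_le_pow m j

/-- The union bound `∏_{i < j} (1 - i / m) ≥ 1 - j² / (2 m)`. -/
theorem mul_pow_le_descFactorial {m j : ℕ} (hj : j ≤ m) :
    (1 - (j : ℝ) ^ 2 / (2 * m)) * (m : ℝ) ^ j ≤ m.descFactorial j := by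
  induction j with
  | zero => simp
  | succ j ih =>
    have hm : (0 : ℝ) < m := by exact_mod_cast (by omega : 0 < m)
    have hjm : (j : ℝ) + 1 ≤ m := by exact_mod_cast hj
    specialize ih (by omega)
    rw [Nat.descFactorial_succ]
    push_cast [Nat.cast_sub (by omega : j ≤ m)]
    have h1 : ((m : ℝ) - j) * ((1 - (j : ℝ) ^ 2 / (2 * m)) * (m : ℝ) ^ j) ≤
        (m - j) * m.descFactorial j := mul_le_mul_of_nonneg_left ih (by linarith)
    refine le_trans ?_ h1
    have e : ((m : ℝ) - j) = (1 - j / m) * m := by field_simp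
    rw [e, pow_succ]
    have h2 : (1 - ((j : ℝ) + 1) ^ 2 / (2 * m)) ≤ (1 - j / m) * (1 - (j : ℝ) ^ 2 / (2 * m)) := by
      have : (1 - (j : ℝ) / m) * (1 - (j : ℝ) ^ 2 / (2 * m)) - (1 - ((j : ℝ) + 1) ^ 2 / (2 * m))
          = 1 / (2 * m) + (j : ℝ) ^ 3 / (2 * m ^ 2) := by field_simp; ring
      have h3 : 0 ≤ 1 / (2 * (m : ℝ)) + (j : ℝ) ^ 3 / (2 * m ^ 2) := by positivity
      linarith
    calc _ ≤ ((1 - j / m) * (1 - (j : ℝ) ^ 2 / (2 * m))) * ((m : ℝ) ^ j * m) := by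
          exact mul_le_mul_of_nonneg_right h2 (by positivity)
      _ = _ := by ring

/-- Pairing the factors `1 - i/m` and `1 - (j-1-i)/m`, whose product is at least `1/2`. -/
theorem pow_sq_le_descFactorial_sq {m j : ℕ} (hj : 2 * j ≤ m) :
    ((m : ℝ) ^ j) ^ 2 ≤ 2 ^ j * (m.descFactorial j : ℝ) ^ 2 := by
  have e : (m.descFactorial j : ℝ) = ∏ i ∈ range j, ((m : ℝ) - i) := by
    rw [Nat.descFactorial_eq_prod_range, Nat.cast_prod]
    refine prod_congr rfl fun i hi => ?_
    rw [Nat.cast_sub]; have := mem_range.1 hi; omega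
  have e2 : (m.descFactorial j : ℝ) ^ 2 =
      ∏ i ∈ range j, ((m : ℝ) - i) * (m - (j - 1 - i : ℕ)) := by
    rw [prod_mul_distrib, prod_range_reflect (fun i => (m : ℝ) - i) j, ← e, sq]
  rw [e2, ← pow_mul, mul_comm j 2, pow_mul, ← card_range j, ← prod_const, card_range,
    ← card_range j, ← prod_const, card_range, ← prod_mul_distrib]
  refine prod_le_prod (fun i _ => by positivity) fun i hi => ?_
  have hi := mem_range.1 hi
  rw [Nat.sub_sub, Nat.cast_sub (by omega)]
  push_cast
  have h1 : (2 : ℝ) * j ≤ m := by exact_mod_cast hj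
  have h2 : (i : ℝ) + 1 ≤ j := by exact_mod_cast hi
  have h3 : (0 : ℝ) ≤ i := by positivity
  nlinarith [mul_nonneg h3 (by linarith : (0 : ℝ) ≤ j - 1 - i),
    mul_nonneg (by positivity : (0 : ℝ) ≤ m) (by linarith : (0 : ℝ) ≤ m - 2 * j)]

theorem wsum_eq_sum_fiber {n : ℕ} (w : Finset (Fin n) → ℝ) {T : Finset (Fin n)}
    {F : Finset (Fin n) → ℝ} (hF : ∀ A, F A = F (A ∩ T)) :
    wsum w F = ∑ B ∈ T.powerset, F B * ∑ A with A ∩ T = B, w A := by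
  rw [wsum, ← sum_fiberwise_of_maps_to (g := fun A => A ∩ T) (t := T.powerset)
    (fun A _ => mem_powerset.2 inter_subset_right)]
  refine sum_congr rfl fun B _ => ?_
  rw [mul_sum]
  refine sum_congr rfl fun A hA => ?_
  rw [hF A, (mem_filter.1 hA).2, mul_comm]

section compare
variable {n k : ℕ} {p : ℝ} {T : Finset (Fin n)}

/-- With `k = p n`, the cube marginal is `k^j (n - k)^l / n^{j + l}`: the slice marginal with powers
in place of falling factorials. -/
theorem pow_mul_cube_marginal (hkn : (k : ℝ) = p * n) (hk : k ≤ n) {B : Finset (Fin n)}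
    (hB : B ⊆ T) :
    (n : ℝ) ^ #T * (p ^ #B * (1 - p) ^ #(T \ B)) =
      (k : ℝ) ^ #B * ((n - k : ℕ) : ℝ) ^ #(T \ B) := by
  rw [← card_sdiff_add_card_eq_card hB, Nat.cast_sub hk, hkn, pow_add,
    show (n : ℝ) - p * n = (1 - p) * n by ring, mul_pow, mul_pow]
  ring

theorem descFactorial_pos_real {m j : ℕ} (h : j ≤ m) : (0 : ℝ) < m.descFactorial j := by
  exact_mod_cast Nat.pos_of_ne_zero (by rw [Ne, Nat.descFactorial_eq_zero_iff_lt]; omega)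

theorem slice_marginal_le (hkn : (k : ℝ) = p * n) (hk : 2 * k ≤ n) (hT : #T ≤ k)
    {B : Finset (Fin n)} (hB : B ⊆ T) :
    ∑ A with A ∩ T = B, sliceW n k A ≤
      (n : ℝ) ^ #T / n.descFactorial #T * (p ^ #B * (1 - p) ^ #(T \ B)) := by
  rw [sum_sliceW_fiber_eq_descFactorial hB hT hk, div_mul_eq_mul_div,
    pow_mul_cube_marginal hkn (by omega) hB]
  refine div_le_div_of_nonneg_right ?_ (by positivity)
  exact mul_le_mul (descFactorial_le_pow_real _ _) (descFactorial_le_pow_real _ _)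
    (by positivity) (by positivity)

theorem pow_div_descFactorial_le {m t : ℕ} (hm : 0 < m) (ht : t ^ 2 ≤ m) :
    (m : ℝ) ^ t / m.descFactorial t ≤ 1 + (t : ℝ) ^ 2 / m := by
  have htm : t ≤ m := le_trans (Nat.le_self_pow two_ne_zero t) ht
  have hm' : (0 : ℝ) < m := by exact_mod_cast hm
  have hx1 : (t : ℝ) ^ 2 / m ≤ 1 := by
    rw [div_le_one hm']; exact_mod_cast ht
  have hx0 : 0 ≤ (t : ℝ) ^ 2 / m := by positivity
  rw [div_le_iff₀ (descFactorial_pos_real htm)]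
  have h := mul_pow_le_descFactorial htm
  rw [show (t : ℝ) ^ 2 / (2 * m) = (t : ℝ) ^ 2 / m / 2 by field_simp] at h
  set x := (t : ℝ) ^ 2 / m
  have h1 : (1 : ℝ) ≤ (1 + x) * (1 - x / 2) := by nlinarith
  calc (m : ℝ) ^ t = 1 * (m : ℝ) ^ t := by ring
    _ ≤ (1 + x) * (1 - x / 2) * (m : ℝ) ^ t :=
        mul_le_mul_of_nonneg_right h1 (by positivity)
    _ = (1 + x) * ((1 - x / 2) * (m : ℝ) ^ t) := by ring
    _ ≤ _ := mul_le_mul_of_nonneg_left h (by positivity)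

theorem abs_slice_marginal_sub_le (hn : 0 < k) (hkn : (k : ℝ) = p * n)
    (hp0 : 0 ≤ p) (hp1 : p ≤ 1) (hk : 2 * k ≤ n)
    (hT : #T ^ 2 ≤ k) {B : Finset (Fin n)} (hB : B ⊆ T) :
    |∑ A with A ∩ T = B, sliceW n k A - p ^ #B * (1 - p) ^ #(T \ B)| ≤
      (#T : ℝ) ^ 2 / k * (p ^ #B * (1 - p) ^ #(T \ B)) := by
  have hTk : #T ≤ k := le_trans (Nat.le_self_pow two_ne_zero _) hT
  have hk' : (0 : ℝ) < k := by exact_mod_cast hn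
  have hnk : (k : ℝ) ≤ (n - k : ℕ) := by exact_mod_cast (by omega : k ≤ n - k)
  have hnn : (k : ℝ) ≤ n := by exact_mod_cast (by omega : k ≤ n)
  have hq : 0 ≤ 1 - p := by linarith
  have hμ : 0 ≤ p ^ #B * (1 - p) ^ #(T \ B) := by positivity
  have hup := slice_marginal_le hkn hk hTk hB
  have hc := card_le_card hB
  have hs := card_sdiff_add_card_eq_card hB
  have hup2 : (n : ℝ) ^ #T / n.descFactorial #T ≤ 1 + (#T : ℝ) ^ 2 / k :=
    (pow_div_descFactorial_le (by omega) (by omega)).trans (by gcongr)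
  have hlow : (1 - (#T : ℝ) ^ 2 / k) * (p ^ #B * (1 - p) ^ #(T \ B)) ≤
      ∑ A with A ∩ T = B, sliceW n k A := by
    rw [sum_sliceW_fiber_eq_descFactorial hB hTk hk,
      le_div_iff₀ (descFactorial_pos_real (by omega))]
    have h1 := mul_pow_le_descFactorial (m := k) (j := #B) (by omega)
    have h2 := mul_pow_le_descFactorial (m := n - k) (j := #(T \ B)) (by omega)
    set j := #B
    set l := #(T \ B)
    set t := #T
    have hst : (t : ℝ) = l + j := by exact_mod_cast hs.symm
    have ht1 : (t : ℝ) ^ 2 / k ≤ 1 := by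
      rw [div_le_one hk']; exact_mod_cast hT
    have hl : (l : ℝ) ^ 2 / (2 * (n - k : ℕ)) ≤ (l : ℝ) ^ 2 / k / 2 := by
      rw [div_div, mul_comm (k : ℝ) 2]; gcongr
    have hj : (j : ℝ) ^ 2 / (2 * k) = (j : ℝ) ^ 2 / k / 2 := by field_simp
    have hjl : (j : ℝ) ^ 2 / k + (l : ℝ) ^ 2 / k ≤ (t : ℝ) ^ 2 / k := by
      rw [← add_div, hst]; gcongr; nlinarith [mul_nonneg (Nat.cast_nonneg (α := ℝ) j)
        (Nat.cast_nonneg (α := ℝ) l)]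
    have hj0 : 0 ≤ (j : ℝ) ^ 2 / k := by positivity
    have hl0 : 0 ≤ (l : ℝ) ^ 2 / k := by positivity
    rw [hj] at h1
    set x := (j : ℝ) ^ 2 / k
    set y := (l : ℝ) ^ 2 / k
    set z := (t : ℝ) ^ 2 / k
    have h2' : (1 - y / 2) * ((n - k : ℕ) : ℝ) ^ l ≤ (n - k).descFactorial l :=
      le_trans (mul_le_mul_of_nonneg_right (by linarith) (by positivity)) h2
    have e := pow_mul_cube_marginal (p := p) (T := T) hkn (by omega) hB
    calc (1 - z) * (p ^ j * (1 - p) ^ l) * n.descFactorial t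
        ≤ (1 - z) * (p ^ j * (1 - p) ^ l) * (n : ℝ) ^ t :=
          mul_le_mul_of_nonneg_left (descFactorial_le_pow_real _ _)
            (mul_nonneg (by linarith) hμ)
      _ = (1 - z) * ((k : ℝ) ^ j * ((n - k : ℕ) : ℝ) ^ l) := by rw [← e]; ring
      _ ≤ ((1 - x / 2) * (1 - y / 2)) * ((k : ℝ) ^ j * ((n - k : ℕ) : ℝ) ^ l) :=
          mul_le_mul_of_nonneg_right (by nlinarith) (by positivity)
      _ = ((1 - x / 2) * (k : ℝ) ^ j) * ((1 - y / 2) * ((n - k : ℕ) : ℝ) ^ l) := by ring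
      _ ≤ _ := mul_le_mul h1 h2' (mul_nonneg (by linarith) (by positivity)) (by positivity)
  rw [abs_le]
  constructor
  · linarith
  · have := hup.trans (mul_le_mul_of_nonneg_right hup2 hμ)
    linarith

/-- A function of few coordinates has almost the same mean on the slice as on the biased cube. -/
theorem abs_wsum_slice_sub_cube_le (hn : 0 < k) (hkn : (k : ℝ) = p * n)
    (hp0 : 0 ≤ p) (hp1 : p ≤ 1) (hk : 2 * k ≤ n) {t : ℕ} (hTt : #T ≤ t)
    (hT : t ^ 2 ≤ k) {F : Finset (Fin n) → ℝ} (hF : ∀ A, F A = F (A ∩ T)) :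
    |wsum (sliceW n k) F - wsum (cubeW p) F| ≤
      (t : ℝ) ^ 2 / k * wsum (cubeW p) fun A => |F A| := by
  rw [wsum_eq_sum_fiber _ hF, wsum_eq_sum_fiber _ hF,
    wsum_eq_sum_fiber _ (F := fun A => |F A|) (T := T) (fun A => by rw [hF A]),
    ← sum_sub_distrib, mul_sum]
  refine (abs_sum_le_sum_abs _ _).trans (sum_le_sum fun B hB => ?_)
  rw [mem_powerset] at hB
  have hT2 : #T ^ 2 ≤ t ^ 2 := by gcongr
  have h := abs_slice_marginal_sub_le hn hkn hp0 hp1 hk (hT2.trans hT) hB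
  have hq : 0 ≤ 1 - p := by linarith
  rw [sum_cubeW_fiber p hB, ← mul_sub, abs_mul]
  calc _ ≤ |F B| * ((#T : ℝ) ^ 2 / k * (p ^ #B * (1 - p) ^ #(T \ B))) := by gcongr
    _ ≤ |F B| * ((t : ℝ) ^ 2 / k * (p ^ #B * (1 - p) ^ #(T \ B))) := by
        gcongr
    _ = _ := by ring

/-- For `t² > n` the bound `2^{t/2}` on the density is absorbed by the error term. -/
theorem pow_div_descFactorial_le_two_add_errorTerm {t : ℕ} (hn : 0 < n) (ht : 2 * t ≤ n) :
    (n : ℝ) ^ t / n.descFactorial t ≤ 2 + errorTerm t n := by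
  have hn' : (0 : ℝ) < n := by exact_mod_cast hn
  have he : 0 ≤ errorTerm t n := by unfold errorTerm; positivity
  rcases le_or_gt (t ^ 2) n with h | h
  · have h1 := pow_div_descFactorial_le hn h
    have h2 : (t : ℝ) ^ 2 / n ≤ 1 := by
      rw [div_le_one hn']; exact_mod_cast h
    linarith
  · have hd := descFactorial_pos_real (m := n) (j := t) (by omega)
    have h1 := pow_sq_le_descFactorial_sq ht
    have h2 : (n : ℝ) ^ t ≤ (2 : ℝ) ^ ((t : ℝ) / 2) * n.descFactorial t := by
      refine abs_le_of_sq_le_sq' ?_ (by positivity) |>.2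
      have e : ((2 : ℝ) ^ ((t : ℝ) / 2)) ^ 2 = 2 ^ t := by
        rw [← Real.rpow_natCast, ← Real.rpow_mul (by norm_num), ← Real.rpow_natCast]
        congr 1; push_cast; ring
      rwa [mul_pow, e]
    have h3 : (2 : ℝ) ^ ((t : ℝ) / 2) ≤ errorTerm t n := by
      unfold errorTerm
      rw [le_div_iff₀ (by positivity), mul_comm]
      refine mul_le_mul_of_nonneg_right ?_ (by positivity)
      rw [Real.sqrt_le_left (by positivity)]
      exact_mod_cast h.le
    rw [div_le_iff₀ hd]
    refine h2.trans (mul_le_mul_of_nonneg_right (by linarith) hd.le)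

theorem errorTerm_nonneg (d n : ℕ) : 0 ≤ errorTerm d n := by
  unfold errorTerm; positivity

theorem errorTerm_mono {d d' : ℕ} (h : d ≤ d') (n : ℕ) : errorTerm d n ≤ errorTerm d' n := by
  unfold errorTerm
  have : (2 : ℝ) ^ ((d : ℝ) / 2) ≤ (2 : ℝ) ^ ((d' : ℝ) / 2) :=
    Real.rpow_le_rpow_of_exponent_le (by norm_num) (by gcongr)
  gcongr

theorem wsum_slice_le_cube (hn : 0 < n) (hkn : (k : ℝ) = p * n)
    (hp0 : 0 ≤ p) (hp1 : p ≤ 1) (hk : 2 * k ≤ n) {t : ℕ} (hTt : #T ≤ t) (htk : t ≤ k)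
    {F : Finset (Fin n) → ℝ} (hF : ∀ A, F A = F (A ∩ T)) (hF0 : ∀ A, 0 ≤ F A) :
    wsum (sliceW n k) F ≤ (2 + errorTerm t n) * wsum (cubeW p) F := by
  rw [wsum_eq_sum_fiber _ hF, wsum_eq_sum_fiber _ hF, mul_sum]
  refine sum_le_sum fun B hB => ?_
  rw [mem_powerset] at hB
  have hq : 0 ≤ 1 - p := by linarith
  have h1 := slice_marginal_le hkn hk (hTt.trans htk) hB
  have h2 := (pow_div_descFactorial_le_two_add_errorTerm hn (t := #T) (by omega)).trans
    (add_le_add_right (errorTerm_mono hTt n) 2)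
  rw [sum_cubeW_fiber p hB]
  calc _ ≤ F B * ((2 + errorTerm t n) * (p ^ #B * (1 - p) ^ #(T \ B))) :=
        mul_le_mul_of_nonneg_left
          (h1.trans (mul_le_mul_of_nonneg_right h2 (by positivity))) (hF0 B)
    _ = _ := by ring

end compare

/-! ### Characters on the cube, and averaging over disjoint copies of the variables -/

noncomputable section

/-- The indicator vector of `A ⊆ [n]`. -/
def ind {n : ℕ} (A : Finset (Fin n)) : Fin n → ℝ := fun i => if i ∈ A then 1 else 0

/-- The normalised coordinate `(y - p) / √(p (1 - p))`. -/
def normCoord (p y : ℝ) : ℝ := 1 / √(p * (1 - p)) * (y - p)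

/-- The value `ω_S(x)` of a Fourier character. -/
def chi {n : ℕ} (p : ℝ) (x : Fin n → ℝ) (S : Finset (Fin n)) : ℝ := ∏ i ∈ S, normCoord p (x i)

end

section cube
variable {n : ℕ} {p : ℝ}

theorem ind_apply_inter {A T : Finset (Fin n)} {i : Fin n} (hi : i ∈ T) :
    ind (A ∩ T) i = ind A i := by
  simp [ind, hi]

theorem chi_ind_inter {A T S : Finset (Fin n)} (hS : S ⊆ T) :
    chi p (ind (A ∩ T)) S = chi p (ind A) S :=
  prod_congr rfl fun i hi => by rw [ind_apply_inter (hS hi)]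

/-- `ω_S ω_T` as a product over all coordinates. -/
theorem chi_mul_chi (x : Fin n → ℝ) (S T : Finset (Fin n)) :
    chi p x S * chi p x T = ∏ i, (if i ∈ S then normCoord p (x i) else 1) *
      (if i ∈ T then normCoord p (x i) else 1) := by
  rw [prod_mul_distrib, prod_ite_mem, prod_ite_mem, univ_inter, univ_inter]; rfl

/-- A product of one-coordinate expectations of `ω_S ω_T`: a coordinate in exactly one of `S` and
`T` contributes `0`. -/
theorem prod_ite_mem_iff (S T : Finset (Fin n)) :
    (∏ i, if (i ∈ S ↔ i ∈ T) then (1 : ℝ) else 0) = if S = T then 1 else 0 := by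
  split_ifs with h
  · subst h; simp
  · have : ∃ i, ¬ (i ∈ S ↔ i ∈ T) := by
      by_contra hc; push Not at hc; exact h (ext hc)
    obtain ⟨i, hi⟩ := this
    exact prod_eq_zero (mem_univ i) (if_neg hi)

theorem wsum_cubeW_prod (u : Fin n → ℝ → ℝ) :
    (wsum (cubeW p) fun A => ∏ i, u i (ind A i)) = ∏ i, (p * u i 1 + (1 - p) * u i 0) := by
  rw [prod_add, powerset_univ, wsum]
  refine sum_congr rfl fun A _ => ?_
  have h1 : ∏ i ∈ A, u i (ind A i) = ∏ i ∈ A, u i 1 :=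
    prod_congr rfl fun i hi => by simp [ind, hi]
  have h2 : ∏ i ∈ Aᶜ, u i (ind A i) = ∏ i ∈ Aᶜ, u i 0 :=
    prod_congr rfl fun i hi => by simp [ind, mem_compl.1 hi]
  rw [← prod_mul_prod_compl A, h1, h2, prod_mul_distrib, prod_mul_distrib, prod_const, prod_const,
    cubeW, compl_eq_univ_sdiff]
  ring

theorem wsum_cubeW_chi_mul_chi (hp0 : 0 < p) (hp1 : p < 1) (S T : Finset (Fin n)) :
    (wsum (cubeW p) fun A => chi p (ind A) S * chi p (ind A) T) = if S = T then 1 else 0 := by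
  simp only [chi_mul_chi]
  rw [wsum_cubeW_prod (p := p) fun i y => (if i ∈ S then normCoord p y else 1) *
      (if i ∈ T then normCoord p y else 1), ← prod_ite_mem_iff]
  refine prod_congr rfl fun i _ => ?_
  have hs : (√(p * (1 - p))) ^ 2 = p * (1 - p) :=
    Real.sq_sqrt (mul_nonneg hp0.le (by linarith))
  have hs0 : √(p * (1 - p)) ≠ 0 := (Real.sqrt_pos.2 (mul_pos hp0 (by linarith))).ne'
  by_cases h1 : i ∈ S <;> by_cases h2 : i ∈ T <;> simp only [h1, h2, normCoord, if_true, if_false,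
    iff_true, iff_false, not_true]
  · field_simp
    rw [hs]; ring
  · ring
  · ring
  · ring

theorem wsum_cubeW_expansion_mul (hp0 : 0 < p) (hp1 : p < 1) {ι : Type*} (I J : Finset ι)
    (α β : ι → ℝ) (U V : ι → Finset (Fin n)) :
    (wsum (cubeW p) fun A => (∑ x ∈ I, α x * chi p (ind A) (U x)) *
      ∑ y ∈ J, β y * chi p (ind A) (V y)) =
    ∑ x ∈ I, ∑ y ∈ J, α x * β y * if U x = V y then 1 else 0 := by
  simp only [sum_mul_sum]
  rw [wsum_sum]
  refine sum_congr rfl fun x _ => ?_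
  rw [wsum_sum]
  refine sum_congr rfl fun y _ => ?_
  rw [← wsum_cubeW_chi_mul_chi hp0 hp1, ← wsum_mul_left]
  congr 1; funext A; ring

end cube

theorem prod_sub_comp_eq {ι R : Type*} [DecidableEq ι] [CommRing R] {S : Finset ι} {τ : ι → ι}
    (hinj : Set.InjOn τ S) (hdisj : ∀ i ∈ S, τ i ∉ S) (v : ι → R) :
    ∏ i ∈ S, (v i - v (τ i)) =
      ∑ P ∈ S.powerset, (-1) ^ #P * ∏ i ∈ (S \ P) ∪ P.image τ, v i := by
  rw [prod_sub]
  refine sum_congr rfl fun P hP => ?_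
  rw [mem_powerset] at hP
  rw [prod_union, prod_image (hinj.mono hP)]
  · ring
  · rw [disjoint_left]
    intro i hi hi2
    obtain ⟨j, hj, rfl⟩ := mem_image.1 hi2
    exact hdisj j (hP hj) (mem_sdiff.1 hi).1

/-- The maps `τ r`, of which only the values on `D` matter, send `D` injectively to pairwise
disjoint subsets of the complement of `D`. -/
structure IsSwapFamily {n m : ℕ} (D : Finset (Fin n)) (τ : Fin m → Fin n → Fin n) : Prop where
  notMem : ∀ r, ∀ i ∈ D, τ r i ∉ D
  inj : ∀ r s, ∀ i ∈ D, ∀ j ∈ D, τ r i = τ s j → r = s ∧ i = j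

theorem exists_isSwapFamily {n m : ℕ} (D : Finset (Fin n)) (h : m * #D + #D ≤ n) :
    ∃ τ : Fin m → Fin n → Fin n, IsSwapFamily D τ := by
  have : Nonempty ((Fin m × D) ↪ (Dᶜ : Finset (Fin n))) := by
    refine Function.Embedding.nonempty_of_card_le ?_
    simp only [Fintype.card_prod, Fintype.card_fin, Fintype.card_coe, card_compl]
    omega
  obtain ⟨e⟩ := this
  refine ⟨fun r i => if hi : i ∈ D then (e (r, ⟨i, hi⟩) : Fin n) else i, ?_, ?_⟩
  · intro r i hi
    simp only [hi, dif_pos]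
    exact mem_compl.1 (e (r, ⟨i, hi⟩)).2
  · intro r s i hi j hj h
    simp only [hi, hj, dif_pos] at h
    have := e.injective (Subtype.ext h)
    simpa using this

section swap
variable {n m : ℕ} {D : Finset (Fin n)} {τ : Fin m → Fin n → Fin n}

/-- The set `U` of indices that arises from `S` when `τ r` replaces the elements of `P ⊆ S`
determines `r`, `S` and `P`, as long as `P` is nonempty. -/
theorem IsSwapFamily.eq_of_swap_eq (h : IsSwapFamily D τ) {r s : Fin m}
    {S P S' P' : Finset (Fin n)} (hS : S ⊆ D) (hP : P ⊆ S) (hne : P.Nonempty)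
    (hS' : S' ⊆ D) (hP' : P' ⊆ S')
    (he : (S \ P) ∪ P.image (τ r) = (S' \ P') ∪ P'.image (τ s)) : r = s ∧ S = S' ∧ P = P' := by
  have key : ∀ {r s : Fin m} {S P S' P' : Finset (Fin n)}, S ⊆ D → P ⊆ S → S' ⊆ D → P' ⊆ S' →
      (S \ P) ∪ P.image (τ r) = (S' \ P') ∪ P'.image (τ s) →
      (∀ i ∈ P, r = s ∧ i ∈ P') ∧ S \ P ⊆ S' \ P' := by
    intro r s S P S' P' hS hP hS' hP' he
    constructor
    · intro i hi
      have h1 : τ r i ∈ (S' \ P') ∪ P'.image (τ s) := by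
        rw [← he]; exact mem_union_right _ (mem_image_of_mem _ hi)
      rcases mem_union.1 h1 with h2 | h2
      · exact absurd (hS' (mem_sdiff.1 h2).1) (h.notMem r i (hS (hP hi)))
      · obtain ⟨j, hj, hji⟩ := mem_image.1 h2
        obtain ⟨e1, e2⟩ := h.inj s r j (hS' (hP' hj)) i (hS (hP hi)) hji
        exact ⟨e1.symm, e2 ▸ hj⟩
    · intro i hi
      have h1 : i ∈ (S' \ P') ∪ P'.image (τ s) := by
        rw [← he]; exact mem_union_left _ hi
      rcases mem_union.1 h1 with h2 | h2
      · exact h2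
      · obtain ⟨j, hj, rfl⟩ := mem_image.1 h2
        exact absurd (hS (mem_sdiff.1 hi).1) (h.notMem s j (hS' (hP' hj)))
  obtain ⟨h1, h2⟩ := key hS hP hS' hP' he
  obtain ⟨h3, h4⟩ := key hS' hP' hS hP he.symm
  obtain ⟨i, hi⟩ := hne
  have e1 : P = P' := Subset.antisymm (fun i hi => (h1 i hi).2) (fun i hi => (h3 i hi).2)
  have e2 : S \ P = S' \ P' := Subset.antisymm h2 h4
  refine ⟨(h1 i hi).1, ?_, e1⟩
  rw [← sdiff_union_of_subset hP, ← sdiff_union_of_subset hP', e2, e1]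

/-- The change of `f = ∑_S b_S ω_S` when every variable `w_i`, `i ∈ D`, is replaced by
`w_i - w_{τ i}`. -/
noncomputable def swapDiff (p : ℝ) (D : Finset (Fin n)) (τ : Fin n → Fin n)
    (b : Finset (Fin n) → ℝ) (A : Finset (Fin n)) : ℝ :=
  ∑ S ∈ D.powerset, b S *
    (∏ i ∈ S, (normCoord p (ind A i) - normCoord p (ind A (τ i))) - chi p (ind A) S)

/-- The pairs `(S, P)` with `P` empty reproduce `f` and cancel. -/
theorem IsSwapFamily.swapDiff_eq (h : IsSwapFamily D τ) (p : ℝ) (r : Fin m)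
    (b : Finset (Fin n) → ℝ) (A : Finset (Fin n)) :
    swapDiff p D (τ r) b A =
      ∑ x ∈ D.powerset.sigma fun S => S.powerset.erase ∅,
        (b x.1 * (-1) ^ #x.2) * chi p (ind A) ((x.1 \ x.2) ∪ x.2.image (τ r)) := by
  rw [sum_sigma, swapDiff]
  refine sum_congr rfl fun S hS => ?_
  rw [mem_powerset] at hS
  rw [prod_sub_comp_eq (v := fun i => normCoord p (ind A i))
    (fun i hi j hj e => (h.inj r r i (hS hi) j (hS hj) e).2)
    (fun i hi hc => h.notMem r i (hS hi) (hS hc)),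
    ← add_sum_erase _ _ (empty_mem_powerset S)]
  simp only [card_empty, pow_zero, sdiff_empty, image_empty, union_empty, one_mul]
  rw [← chi, add_sub_cancel_left, mul_sum]
  refine sum_congr rfl fun P _ => ?_
  rw [← chi]; ring

theorem IsSwapFamily.wsum_cubeW_swapDiff_mul (h : IsSwapFamily D τ) {p : ℝ} (hp0 : 0 < p)
    (hp1 : p < 1) (b : Finset (Fin n) → ℝ) (r s : Fin m) :
    (wsum (cubeW p) fun A => swapDiff p D (τ r) b A * swapDiff p D (τ s) b A) =
      if r = s then ∑ S ∈ D.powerset, b S ^ 2 * (2 ^ #S - 1) else 0 := by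
  simp only [h.swapDiff_eq]
  rw [wsum_cubeW_expansion_mul hp0 hp1]
  have hI : ∀ x : (_ : Finset (Fin n)) × Finset (Fin n),
      x ∈ (D.powerset.sigma fun S => S.powerset.erase ∅) →
      x.1 ⊆ D ∧ x.2 ⊆ x.1 ∧ x.2.Nonempty := by
    intro x hx
    simp only [mem_sigma, mem_powerset, mem_erase] at hx
    exact ⟨hx.1, hx.2.2, nonempty_iff_ne_empty.2 hx.2.1⟩
  split_ifs with hrs
  · subst hrs
    have : ∀ x ∈ (D.powerset.sigma fun S => S.powerset.erase ∅),
        (∑ y ∈ D.powerset.sigma fun S => S.powerset.erase ∅,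
          b x.1 * (-1) ^ #x.2 * (b y.1 * (-1) ^ #y.2) *
          if (x.1 \ x.2) ∪ x.2.image (τ r) = (y.1 \ y.2) ∪ y.2.image (τ r) then (1 : ℝ) else 0)
        = b x.1 ^ 2 := by
      intro x hx
      rw [sum_eq_single_of_mem x hx]
      · rw [if_pos rfl]
        have : ((-1 : ℝ) ^ #x.2) * (-1) ^ #x.2 = 1 := by rw [← mul_pow]; simp
        linear_combination b x.1 ^ 2 * this
      · intro y hy hyx
        rw [if_neg, mul_zero]
        intro he
        obtain ⟨h1, h2, h3⟩ := hI x hx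
        obtain ⟨h1', h2', -⟩ := hI y hy
        obtain ⟨-, e1, e2⟩ := h.eq_of_swap_eq h1 h2 h3 h1' h2' he
        exact hyx (Sigma.ext e1.symm (heq_of_eq e2.symm))
    rw [sum_congr rfl this, sum_sigma]
    refine sum_congr rfl fun S _ => ?_
    simp only [sum_const, nsmul_eq_mul]
    rw [card_erase_of_mem (empty_mem_powerset S), card_powerset, Nat.cast_sub Nat.one_le_two_pow]
    push_cast; ring
  · refine sum_eq_zero fun x hx => sum_eq_zero fun y hy => ?_
    rw [if_neg, mul_zero]
    intro he
    obtain ⟨h1, h2, h3⟩ := hI x hx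
    obtain ⟨h1', h2', -⟩ := hI y hy
    exact hrs (h.eq_of_swap_eq h1 h2 h3 h1' h2' he).1

theorem swapDiff_inter (p : ℝ) (τ : Fin n → Fin n) (b : Finset (Fin n) → ℝ)
    {T : Finset (Fin n)} (hT : D ∪ D.image τ ⊆ T) (A : Finset (Fin n)) :
    swapDiff p D τ b (A ∩ T) = swapDiff p D τ b A := by
  refine sum_congr rfl fun S hS => ?_
  rw [mem_powerset] at hS
  have h1 : S ⊆ T := hS.trans (subset_union_left.trans hT)
  rw [chi_ind_inter h1]
  congr 2
  refine prod_congr rfl fun i hi => ?_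
  rw [ind_apply_inter (h1 hi), ind_apply_inter
    (hT (mem_union_right _ (mem_image_of_mem _ (hS hi))))]

/-- Averaging `f(w_i - w_{τ i})` over about `k / d` disjoint copies `τ D` of `D` changes a
function `f = ∑_S b_S ω_S` of `d` variables little on the slice. The products of two changes
depend on at most `3 d` variables, hence have nearly the same mean on the slice as on the cube,
where different changes are orthogonal. -/
theorem IsSwapFamily.wsum_sliceW_avg_sq_le {k d : ℕ} {τ : Fin (k / d + 1) → Fin n → Fin n}
    (h : IsSwapFamily D τ) {p : ℝ} (hp0 : 0 < p) (hp1 : p < 1) (hn : 0 < k)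
    (hkn : (k : ℝ) = p * n) (hk : 2 * k ≤ n) (hD : #D ≤ d) (hd : 9 * d ^ 2 ≤ k)
    (b : Finset (Fin n) → ℝ) :
    (wsum (sliceW n k) fun A => (1 / ((k / d + 1 : ℕ) : ℝ) * ∑ r, swapDiff p D (τ r) b A) ^ 2) ≤
      10 * d ^ 2 * 2 ^ d / k * ∑ S ∈ D.powerset, b S ^ 2 := by
  have hk' : (0 : ℝ) < k := by exact_mod_cast hn
  set N : ℝ := ∑ S ∈ D.powerset, b S ^ 2 with hN
  have hN0 : 0 ≤ N := sum_nonneg fun S _ => sq_nonneg _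
  set V : ℝ := ∑ S ∈ D.powerset, b S ^ 2 * (2 ^ #S - 1) with hV
  have hVle : V ≤ (2 ^ d - 1) * N := by
    rw [hV, hN, mul_sum]
    refine sum_le_sum fun S hS => ?_
    rw [mul_comm]
    refine mul_le_mul_of_nonneg_right ?_ (sq_nonneg _)
    have : (2 : ℝ) ^ #S ≤ 2 ^ d :=
      pow_le_pow_right₀ (by norm_num) ((card_le_card (mem_powerset.1 hS)).trans hD)
    linarith
  set M : ℝ := ((k / d + 1 : ℕ) : ℝ) with hM
  have hM0 : 0 < M := by rw [hM]; positivity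
  have hpair : ∀ r s, (wsum (sliceW n k) fun A =>
      swapDiff p D (τ r) b A * swapDiff p D (τ s) b A) ≤
      (if r = s then V else 0) + 9 * d ^ 2 / k * V := by
    intro r s
    have hcard : #((D ∪ D.image (τ r)) ∪ (D ∪ D.image (τ s))) ≤ 3 * d := by
      have e : (D ∪ D.image (τ r)) ∪ (D ∪ D.image (τ s)) =
          D ∪ (D.image (τ r) ∪ D.image (τ s)) := by
        ext i; simp only [mem_union]; tauto
      rw [e]
      have h1 := card_union_le D (D.image (τ r) ∪ D.image (τ s))
      have h2 := card_union_le (D.image (τ r)) (D.image (τ s))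
      have h3 := card_image_le (s := D) (f := τ r)
      have h4 := card_image_le (s := D) (f := τ s)
      omega
    have hcmp := abs_wsum_slice_sub_cube_le (F := fun A =>
      swapDiff p D (τ r) b A * swapDiff p D (τ s) b A) hn hkn hp0.le hp1.le hk hcard
      (by rw [mul_pow]; omega) (fun A => by
        rw [swapDiff_inter _ _ _ subset_union_left, swapDiff_inter _ _ _ subset_union_right])
    have habs : (wsum (cubeW p) fun A => |swapDiff p D (τ r) b A * swapDiff p D (τ s) b A|) ≤
        V := by
      have e : V = 1 / 2 * (wsum (cubeW p) fun A =>
          swapDiff p D (τ r) b A * swapDiff p D (τ r) b A) + 1 / 2 * (wsum (cubeW p) fun A =>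
          swapDiff p D (τ s) b A * swapDiff p D (τ s) b A) := by
        rw [h.wsum_cubeW_swapDiff_mul hp0 hp1, h.wsum_cubeW_swapDiff_mul hp0 hp1, if_pos rfl,
          if_pos rfl]
        ring
      rw [e, ← wsum_mul_left, ← wsum_mul_left, ← wsum_add]
      refine wsum_mono (cubeW_nonneg hp0.le hp1.le) fun A => ?_
      rw [abs_mul]
      nlinarith [sq_nonneg (|swapDiff p D (τ r) b A| - |swapDiff p D (τ s) b A|),
        sq_abs (swapDiff p D (τ r) b A), sq_abs (swapDiff p D (τ s) b A)]
    rw [h.wsum_cubeW_swapDiff_mul hp0 hp1] at hcmp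
    have h1 := (abs_le.1 hcmp).2
    have h2 : ((3 * d : ℕ) : ℝ) ^ 2 / k * (wsum (cubeW p) fun A =>
        |swapDiff p D (τ r) b A * swapDiff p D (τ s) b A|) ≤ 9 * d ^ 2 / k * V := by
      rw [show ((3 * d : ℕ) : ℝ) ^ 2 = 9 * d ^ 2 by push_cast; ring]
      gcongr
    linarith
  have hexp : (wsum (sliceW n k) fun A => (1 / M * ∑ r, swapDiff p D (τ r) b A) ^ 2) =
      (1 / M) ^ 2 * ∑ r, ∑ s, wsum (sliceW n k) fun A =>
        swapDiff p D (τ r) b A * swapDiff p D (τ s) b A := by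
    simp only [← wsum_sum, ← wsum_mul_left]
    congr 1; funext A
    rw [mul_pow, sq (∑ r, _), sum_mul_sum]
  rw [hexp]
  have hsum : (∑ r, ∑ s, wsum (sliceW n k) fun A =>
      swapDiff p D (τ r) b A * swapDiff p D (τ s) b A) ≤ M * V + M ^ 2 * (9 * d ^ 2 / k * V) := by
    refine (sum_le_sum fun r _ => sum_le_sum fun s _ => hpair r s).trans (le_of_eq ?_)
    simp only [sum_add_distrib, sum_ite_eq, mem_univ, if_true, sum_const, card_univ,
      Fintype.card_fin, nsmul_eq_mul]
    rw [← hM]; ring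
  -- The factor `2 ^ d - 1` rather than `2 ^ d` covers `d = 0`, where `M = 1`.
  have hMk : 1 / M * (2 ^ d - 1) ≤ (d : ℝ) ^ 2 / k * 2 ^ d := by
    rcases Nat.eq_zero_or_pos d with rfl | hd0
    · simp
    · have h1 : (k : ℝ) ≤ d * M := by
        rw [hM]; exact_mod_cast (Nat.lt_mul_div_succ k hd0).le
      have hd1 : (1 : ℝ) ≤ d := by exact_mod_cast hd0
      have h2 : 1 / M ≤ (d : ℝ) ^ 2 / k := by
        rw [div_le_div_iff₀ hM0 hk', one_mul]
        refine h1.trans ?_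
        nlinarith [mul_nonneg (by linarith : (0 : ℝ) ≤ d) hM0.le]
      have h3 : (1 : ℝ) ≤ 2 ^ d := one_le_pow₀ (by norm_num)
      refine mul_le_mul h2 (by linarith) (by linarith) (by positivity)
  calc _ ≤ (1 / M) ^ 2 * (M * V + M ^ 2 * (9 * d ^ 2 / k * V)) := by gcongr
    _ = (1 / M + 9 * d ^ 2 / k) * V := by field_simp
    _ ≤ (1 / M + 9 * d ^ 2 / k) * ((2 ^ d - 1) * N) := by gcongr
    _ = (1 / M * (2 ^ d - 1) + 9 * d ^ 2 / k * (2 ^ d - 1)) * N := by ring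
    _ ≤ ((d : ℝ) ^ 2 / k * 2 ^ d + 9 * d ^ 2 / k * 2 ^ d) * N := by
        refine mul_le_mul_of_nonneg_right (add_le_add hMk ?_) hN0
        refine mul_le_mul_of_nonneg_left (by linarith) (by positivity)
    _ = _ := by ring

end swap

/-! ### Harmonic coefficient vectors -/

/-- The multilinear polynomial `∑_S a_S x_S` is harmonic: the left side is the coefficient of `x_R`
in the sum of its partial derivatives. -/
def HarmCoeff {n : ℕ} (a : Finset (Fin n) → ℝ) : Prop :=
  ∀ R, ∑ j ∈ Rᶜ, a (insert j R) = 0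

/-- The value of the multilinear polynomial `∑_S a_S x_S` at the indicator vector of `A`. -/
noncomputable def ev {n : ℕ} (a : Finset (Fin n) → ℝ) (A : Finset (Fin n)) : ℝ :=
  ∑ S, if S ⊆ A then a S else 0

/-- The coefficient of `x_S` multiplied by `c |S|`. -/
def levelMul {n : ℕ} (c : ℕ → ℝ) (a : Finset (Fin n) → ℝ) (S : Finset (Fin n)) : ℝ :=
  c #S * a S

section harm
variable {n : ℕ} {a : Finset (Fin n) → ℝ}

theorem HarmCoeff.levelMul (h : HarmCoeff a) (c : ℕ → ℝ) : HarmCoeff (levelMul c a) := by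
  intro R
  have : ∀ j ∈ Rᶜ, HarmonicSlice.levelMul c a (insert j R) = c (#R + 1) * a (insert j R) := by
    intro j hj
    rw [HarmonicSlice.levelMul, card_insert_of_notMem (mem_compl.1 hj)]
  rw [sum_congr rfl this, ← mul_sum, h R, mul_zero]

/-- Summing the harmonicity relations over all `R ⊇ A` counts each `S ⊇ A` exactly `i - |A|`
times. -/
theorem HarmCoeff.sum_superset_eq_zero (h : HarmCoeff a) {i : ℕ} (ha : ∀ S, #S ≠ i → a S = 0)
    {A : Finset (Fin n)} (hA : #A < i) : ∑ S with A ⊆ S, a S = 0 := by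
  have h1 : ∑ R with A ⊆ R, ∑ j ∈ Rᶜ, a (insert j R) = 0 :=
    sum_eq_zero fun R _ => h R
  have h2 : ∑ R with A ⊆ R, ∑ j ∈ Rᶜ, a (insert j R) =
      ∑ S with A ⊆ S, ∑ j ∈ S \ A, a S := by
    rw [sum_sigma', sum_sigma']
    refine sum_nbij' (fun x => ⟨insert x.2 x.1, x.2⟩) (fun x => ⟨x.1.erase x.2, x.2⟩)
      ?_ ?_ ?_ ?_ ?_
    · rintro ⟨R, j⟩ hx
      simp only [mem_sigma, mem_filter, mem_univ, true_and, mem_compl, mem_sdiff,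
        mem_insert_self] at hx ⊢
      exact ⟨hx.1.trans (subset_insert _ _), fun hj => hx.2 (hx.1 hj)⟩
    · rintro ⟨S, j⟩ hx
      simp only [mem_sigma, mem_filter, mem_univ, true_and, mem_compl, mem_sdiff] at hx ⊢
      exact ⟨subset_erase.2 ⟨hx.1, hx.2.2⟩, notMem_erase _ _⟩
    · rintro ⟨R, j⟩ hx
      simp only [mem_sigma, mem_compl] at hx
      simp only [erase_insert hx.2]
    · rintro ⟨S, j⟩ hx
      simp only [mem_sigma, mem_sdiff] at hx
      simp only [insert_erase hx.2.1]
    · rintro ⟨R, j⟩ _; rfl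
  have h3 : ∑ S with A ⊆ S, ∑ j ∈ S \ A, a S = ((i : ℝ) - #A) * ∑ S with A ⊆ S, a S := by
    rw [mul_sum]
    refine sum_congr rfl fun S hS => ?_
    have hS := (mem_filter.1 hS).2
    by_cases hc : #S = i
    · rw [sum_const, nsmul_eq_mul, card_sdiff_of_subset hS, hc, Nat.cast_sub hA.le]
    · simp [ha S hc]
  rw [h2, h3] at h1
  have : (#A : ℝ) < i := by exact_mod_cast hA
  exact (mul_eq_zero.1 h1).resolve_left (by linarith)

/-- Excluding the elements of `B` one at a time moves each of them, with a sign, to the contained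
set, because the sums with fewer than `i` prescribed elements vanish. -/
theorem HarmCoeff.sum_superset_disjoint (h : HarmCoeff a) {i : ℕ} (ha : ∀ S, #S ≠ i → a S = 0)
    (B : Finset (Fin n)) : ∀ A, Disjoint A B → #A + #B ≤ i →
    ∑ S with A ⊆ S ∧ Disjoint S B, a S = (-1) ^ #B * ∑ S with A ∪ B ⊆ S, a S := by
  induction B using Finset.induction_on with
  | empty => intro A _ _; simp
  | insert x B hx ih =>
    intro A hd hc
    rw [card_insert_of_notMem hx] at hc ⊢
    rw [disjoint_insert_right] at hd
    have hxA : #(insert x A) = #A + 1 := card_insert_of_notMem hd.1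
    have h0 : ∑ S with A ⊆ S ∧ Disjoint S B, a S = 0 := by
      rw [ih A hd.2 (by omega), h.sum_superset_eq_zero ha, mul_zero]
      rw [card_union_of_disjoint hd.2]; omega
    have h1 := ih (insert x A) (by rw [disjoint_insert_left]; exact ⟨hx, hd.2⟩) (by omega)
    have h2 : ∑ S with A ⊆ S ∧ Disjoint S B, a S =
        ∑ S with A ⊆ S ∧ Disjoint S (insert x B), a S +
        ∑ S with insert x A ⊆ S ∧ Disjoint S B, a S := by
      rw [← sum_filter_add_sum_filter_not _ (fun S => x ∉ S)]
      congr 1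
      · refine sum_congr ?_ fun _ _ => rfl
        ext S; simp only [mem_filter, mem_univ, true_and, disjoint_insert_right]; tauto
      · refine sum_congr ?_ fun _ _ => rfl
        ext S; simp only [mem_filter, mem_univ, true_and, insert_subset_iff]; tauto
    rw [h1] at h2
    have e : A ∪ insert x B = insert x A ∪ B := by
      ext i; simp only [mem_union, mem_insert]; tauto
    rw [e, pow_succ]
    linarith

/-- A function of the trace of `S` on a small set `T` is, against harmonic coefficients, seen only
through its top-degree Möbius coefficient. -/
theorem HarmCoeff.sum_mul_inter (h : HarmCoeff a) {i : ℕ} (ha : ∀ S, #S ≠ i → a S = 0)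
    {T : Finset (Fin n)} (hT : #T ≤ i) (ψ : Finset (Fin n) → ℝ) :
    ∑ S, a S * ψ (S ∩ T) =
      (if #T = i then a T else 0) * ∑ A ∈ T.powerset, (-1) ^ #(T \ A) * ψ A := by
  have hσ : ∑ S with T ⊆ S, a S = if #T = i then a T else 0 := by
    split_ifs with hc
    · rw [sum_eq_single_of_mem T (by simp)]
      intro S hS hne
      refine ha S fun hc2 => hne ?_
      exact (eq_of_subset_of_card_le (mem_filter.1 hS).2 (by omega)).symm
    · exact h.sum_superset_eq_zero ha (by omega)
  rw [← sum_fiberwise_of_maps_to (g := fun S => S ∩ T) (t := T.powerset)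
    (fun S _ => mem_powerset.2 inter_subset_right), mul_sum]
  refine sum_congr rfl fun A hA => ?_
  rw [mem_powerset] at hA
  have e : ∑ S with S ∩ T = A, a S * ψ (S ∩ T) =
      (∑ S with A ⊆ S ∧ Disjoint S (T \ A), a S) * ψ A := by
    have hfe : ∀ S, S ∩ T = A ↔ A ⊆ S ∧ Disjoint S (T \ A) := by
      intro S
      constructor
      · rintro rfl
        refine ⟨inter_subset_left, disjoint_left.2 fun j hj hj2 => ?_⟩
        simp only [mem_sdiff, mem_inter] at hj2; tauto
      · rintro ⟨h1, h2⟩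
        ext j
        have h3 := @h1 j
        have h4 := @hA j
        have h5 : j ∈ S → j ∉ T \ A := fun hj => disjoint_left.1 h2 hj
        simp only [mem_sdiff, mem_inter] at h5 ⊢; tauto
    simp only [← hfe]
    rw [sum_mul]
    refine sum_congr rfl fun S hS => ?_
    rw [(mem_filter.1 hS).2]
  have hc := card_sdiff_add_card_eq_card hA
  rw [e, h.sum_superset_disjoint ha (T \ A) A disjoint_sdiff (by omega),
    union_sdiff_of_subset hA, hσ]
  ring

/-- The probability that a random `k`-subset of `[n]` contains a given set of size `s`. The case
distinction is needed because `k - s` is truncated. -/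
noncomputable def containProb (n k s : ℕ) : ℝ :=
  if s ≤ k then ((n - s).choose (k - s) : ℝ) / (n.choose k : ℝ) else 0

theorem wsum_sliceW_subset (k : ℕ) (W : Finset (Fin n)) :
    (wsum (sliceW n k) fun A => if W ⊆ A then 1 else 0) = containProb n k #W := by
  rw [containProb, ← sum_sliceW_fiber k (Subset.refl W), sum_filter, wsum]
  refine sum_congr rfl fun A _ => ?_
  simp only [inter_eq_right, mul_ite, mul_one, mul_zero]

/-- The probability that a random `k`-subset of `[n]` contains `i` given elements and misses `i`
others, for `2 i ≤ n`; the definition is the inclusion-exclusion formula. -/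
noncomputable def splitProb (n k i : ℕ) : ℝ :=
  ∑ j ∈ range (i + 1), (i.choose j : ℝ) * ((-1) ^ j * containProb n k (i + j))

theorem sum_powerset_eq_splitProb (k : ℕ) (T : Finset (Fin n)) :
    ∑ A ∈ T.powerset, (-1) ^ #A * containProb n k (#T + #A) = splitProb n k #T := by
  rw [sum_powerset_apply_card (fun j => (-1 : ℝ) ^ j * containProb n k (#T + j)), splitProb]
  simp only [nsmul_eq_mul]

theorem splitProb_pos {k i : ℕ} (hi : i ≤ k) (hk : k + i ≤ n) : 0 < splitProb n k i := by
  obtain ⟨X, -, hX⟩ := exists_subset_card_eq (s := (univ : Finset (Fin n))) (n := k)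
    (by simp; omega)
  obtain ⟨W, hWX, hW⟩ := exists_subset_card_eq (s := X) (n := i) (by omega)
  obtain ⟨T, hTX, hT⟩ := exists_subset_card_eq (s := Xᶜ) (n := i)
    (by rw [card_compl, Fintype.card_fin]; omega)
  have hWT : Disjoint W T :=
    disjoint_of_subset_left hWX (disjoint_of_subset_right hTX disjoint_compl_right)
  have key : splitProb n k i = wsum (sliceW n k) fun A => if W ⊆ A ∧ T ∩ A = ∅ then 1 else 0 := by
    rw [← hT, ← sum_powerset_eq_splitProb]
    have : ∀ A ∈ T.powerset, (-1) ^ #A * containProb n k (#T + #A) =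
        wsum (sliceW n k) fun Y => (-1) ^ #A * if W ∪ A ⊆ Y then 1 else 0 := by
      intro A hA
      rw [wsum_mul_left, wsum_sliceW_subset, card_union_of_disjoint, hW, hT]
      exact disjoint_of_subset_right (mem_powerset.1 hA) hWT
    rw [sum_congr rfl this, ← wsum_sum]
    congr 1; funext Y
    by_cases h1 : W ⊆ Y
    · have e : ∑ A ∈ T.powerset, (-1 : ℝ) ^ #A * (if W ∪ A ⊆ Y then 1 else 0) =
          ∑ A ∈ (T ∩ Y).powerset, (-1 : ℝ) ^ #A := by
        simp only [mul_ite, mul_one, mul_zero]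
        rw [← sum_filter]
        refine sum_congr ?_ fun _ _ => rfl
        ext A; simp only [mem_filter, mem_powerset, union_subset_iff, subset_inter_iff]; tauto
      rw [e]
      have := sum_powerset_neg_one_pow_card (x := T ∩ Y)
      have h2 : ∑ A ∈ (T ∩ Y).powerset, (-1 : ℝ) ^ #A = if T ∩ Y = ∅ then 1 else 0 := by
        exact_mod_cast this
      rw [h2]; simp [h1]
    · rw [if_neg (by tauto)]
      refine sum_eq_zero fun A _ => ?_
      rw [if_neg, mul_zero]
      exact fun h => h1 (union_subset_left h)
  rw [key, wsum]
  refine sum_pos' (fun A _ => mul_nonneg (sliceW_nonneg A) (by split_ifs <;> simp))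
    ⟨X, mem_univ _, ?_⟩
  rw [if_pos, mul_one, sliceW, if_pos hX]
  · have : 0 < n.choose k := Nat.choose_pos (by omega)
    positivity
  · refine ⟨hWX, ?_⟩
    rw [← disjoint_iff_inter_eq_empty]
    exact disjoint_of_subset_left hTX disjoint_compl_left

/-- A homogeneous harmonic polynomial of degree `i` is orthogonal on the slice to all monomials
of smaller degree, and its inner product with `x_T`, `|T| = i`, is proportional to its
coefficient at `T`. -/
theorem HarmCoeff.wsum_ev_mul_monomial (h : HarmCoeff a) {i : ℕ} (ha : ∀ S, #S ≠ i → a S = 0)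
    (k : ℕ) {T : Finset (Fin n)} (hT : #T ≤ i) :
    (wsum (sliceW n k) fun A => ev a A * if T ⊆ A then 1 else 0) =
      if #T = i then splitProb n k i * a T else 0 := by
  have h1 : (wsum (sliceW n k) fun A => ev a A * if T ⊆ A then 1 else 0) =
      ∑ S, a S * containProb n k (i + #T - #(S ∩ T)) := by
    simp only [ev, sum_mul]
    rw [wsum_sum]
    refine sum_congr rfl fun S _ => ?_
    by_cases hS : #S = i
    · have e : i + #T - #(S ∩ T) = #(S ∪ T) := by
        have := card_union_add_card_inter S T
        omega
      rw [e, ← wsum_sliceW_subset, ← wsum_mul_left]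
      congr 1; funext A
      by_cases h1 : S ⊆ A <;> by_cases h2 : T ⊆ A <;> simp [h1, h2, union_subset_iff]
    · simp [ha S hS, wsum]
  rw [h1, h.sum_mul_inter ha hT fun A => containProb n k (i + #T - #A)]
  split_ifs with hc
  · rw [mul_comm]
    congr 1
    rw [← hc, ← sum_powerset_eq_splitProb]
    refine sum_nbij' (fun A => T \ A) (fun A => T \ A) ?_ ?_ ?_ ?_ ?_
    · intro A _; simp
    · intro A _; simp
    · intro A hA; simpa using mem_powerset.1 hA
    · intro A hA; simpa using mem_powerset.1 hA
    · intro A hA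
      have := card_sdiff_add_card_eq_card (mem_powerset.1 hA)
      congr 2
      omega
  · rw [zero_mul]

theorem HarmCoeff.wsum_ev_mul_ev (h : HarmCoeff a) {i : ℕ} (ha : ∀ S, #S ≠ i → a S = 0)
    (k : ℕ) {b : Finset (Fin n) → ℝ} (hb : ∀ S, i < #S → b S = 0) :
    (wsum (sliceW n k) fun A => ev a A * ev b A) =
      splitProb n k i * ∑ S, a S * b S := by
  have h1 : ∀ A, ev a A * ev b A = ∑ T, b T * (ev a A * if T ⊆ A then 1 else 0) := by
    intro A
    rw [ev, ev, mul_sum]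
    refine sum_congr rfl fun T _ => ?_
    split_ifs <;> ring
  simp only [h1]
  rw [wsum_sum, mul_sum]
  refine sum_congr rfl fun T _ => ?_
  rw [wsum_mul_left]
  by_cases hT : i < #T
  · rw [hb T hT]; ring
  · rw [h.wsum_ev_mul_monomial ha k (by omega)]
    split_ifs with hc
    · ring
    · rw [ha T hc]; ring

/-- The coefficients of degree `i`. -/
noncomputable def levelOf (i : ℕ) (a : Finset (Fin n) → ℝ) : Finset (Fin n) → ℝ :=
  levelMul (fun j => if j = i then 1 else 0) a

theorem levelOf_eq_zero (i : ℕ) (a : Finset (Fin n) → ℝ) (S : Finset (Fin n)) (h : #S ≠ i) :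
    levelOf i a S = 0 := by
  simp [levelOf, levelMul, h]

theorem ev_levelMul (c : ℕ → ℝ) (a : Finset (Fin n) → ℝ) (A : Finset (Fin n)) :
    ev (levelMul c a) A = ∑ i ∈ range (n + 1), c i * ev (levelOf i a) A := by
  simp only [ev, mul_sum]
  rw [sum_comm]
  refine sum_congr rfl fun S _ => ?_
  split_ifs
  · have hS : #S ∈ range (n + 1) := by
      have := card_le_univ S
      rw [Fintype.card_fin] at this
      exact mem_range.2 (by omega)
    rw [sum_eq_single_of_mem _ hS]
    · simp [levelMul, levelOf]
    · intro i _ hi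
      rw [levelOf_eq_zero i a S (Ne.symm hi), mul_zero]
  · simp

/-- Homogeneous harmonic polynomials of different degrees are orthogonal on every slice. -/
theorem HarmCoeff.wsum_ev_levelMul_mul (h : HarmCoeff a) (k : ℕ) (c e : ℕ → ℝ) :
    (wsum (sliceW n k) fun A => ev (HarmonicSlice.levelMul c a) A *
      ev (HarmonicSlice.levelMul e a) A) =
      ∑ i ∈ range (n + 1), c i * e i * wsum (sliceW n k) fun A => ev (levelOf i a) A ^ 2 := by
  have hlt : ∀ i j, j < i → (wsum (sliceW n k) fun A => ev (levelOf i a) A * ev (levelOf j a) A)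
      = 0 := by
    intro i j hij
    have hl : HarmCoeff (levelOf i a) := h.levelMul _
    rw [hl.wsum_ev_mul_ev (levelOf_eq_zero i a) k
      (fun S hS => levelOf_eq_zero j a S (by omega))]
    rw [sum_eq_zero, mul_zero]
    intro S _
    by_cases hS : #S = i
    · rw [levelOf_eq_zero j a S (by omega), mul_zero]
    · rw [levelOf_eq_zero i a S hS, zero_mul]
  simp only [ev_levelMul, sum_mul_sum]
  rw [wsum_sum]
  refine sum_congr rfl fun i hi => ?_
  rw [wsum_sum, sum_eq_single_of_mem i hi]
  · rw [← wsum_mul_left]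
    congr 1; funext A; ring
  · intro j _ hji
    have e1 : (fun A => c i * ev (levelOf i a) A * (e j * ev (levelOf j a) A)) =
        fun A => c i * e j * (ev (levelOf i a) A * ev (levelOf j a) A) := by funext A; ring
    rw [e1, wsum_mul_left]
    rcases lt_or_gt_of_ne hji with h1 | h1
    · rw [hlt i j h1, mul_zero]
    · have := hlt j i h1
      simp only [mul_comm (ev (levelOf j a) _)] at this
      rw [this, mul_zero]

theorem levelMul_one (a : Finset (Fin n) → ℝ) : levelMul (fun _ => 1) a = a := by
  funext S; simp [levelMul]

/-- Damping the homogeneous parts of a harmonic polynomial does not increase its norm. -/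
theorem HarmCoeff.wsum_ev_levelMul_sq_le (h : HarmCoeff a) (k : ℕ) {c : ℕ → ℝ}
    (h0 : ∀ i, 0 ≤ c i) (h1 : ∀ i, c i ≤ 1) :
    (wsum (sliceW n k) fun A => ev (HarmonicSlice.levelMul c a) A ^ 2) ≤
      wsum (sliceW n k) fun A => ev a A ^ 2 := by
  have e1 := h.wsum_ev_levelMul_mul k c c
  have e2 := h.wsum_ev_levelMul_mul k (fun _ => 1) (fun _ => 1)
  simp only [levelMul_one, ← sq] at e1 e2
  rw [e1, e2]
  refine sum_le_sum fun i _ => mul_le_mul_of_nonneg_right ?_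
    (wsum_nonneg sliceW_nonneg fun A => sq_nonneg _)
  exact pow_le_pow_left₀ (h0 i) (h1 i) 2

theorem HarmCoeff.eq_zero_of_ev_eq_zero (h : HarmCoeff a) {k : ℕ} (hk : 2 * k ≤ n)
    (ha : ∀ S, k < #S → a S = 0) (hev : ∀ A, #A = k → ev a A = 0) : a = 0 := by
  have hz : (wsum (sliceW n k) fun A => ev a A ^ 2) = 0 := by
    refine sum_eq_zero fun A _ => ?_
    by_cases hA : #A = k
    · simp [hev A hA]
    · simp [sliceW, hA]
  have e2 := h.wsum_ev_levelMul_mul k (fun _ => 1) (fun _ => 1)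
  simp only [levelMul_one, ← sq] at e2
  rw [hz] at e2
  have hi := (sum_eq_zero_iff_of_nonneg (fun i _ => by
    have := wsum_nonneg (sliceW_nonneg (n := n) (k := k)) fun A => sq_nonneg (ev (levelOf i a) A)
    linarith)).1 e2.symm
  funext S
  by_cases hS : k < #S
  · exact ha S hS
  have hSr : #S ∈ range (n + 1) := mem_range.2 (by omega)
  have h3 := hi _ hSr
  have hl : HarmCoeff (levelOf #S a) := h.levelMul _
  have h4 := hl.wsum_ev_mul_ev (levelOf_eq_zero #S a) k
      (b := levelOf #S a) (fun S' hS' => levelOf_eq_zero _ a S' (by omega))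
  simp only [← sq] at h4
  rw [h4] at h3
  have hpos := splitProb_pos (n := n) (k := k) (i := #S) (by omega) (by omega)
  have h5 : ∑ S', levelOf #S a S' ^ 2 = 0 := by
    simp only [one_pow, one_mul] at h3
    exact (mul_eq_zero.1 h3).resolve_left hpos.ne'
  have h6 := (sum_eq_zero_iff_of_nonneg fun _ _ => sq_nonneg _).1 h5 S (mem_univ S)
  simpa [levelOf, HarmonicSlice.levelMul] using h6

/-- Every function on the slice is represented by a harmonic polynomial of degree at most `k`.
The endomorphism of coefficient vectors that returns `∑_i ∂_i` in degrees below `k`, the values on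
the slice in degree `k`, and the coefficient itself above, is injective, hence surjective. -/
theorem exists_harmCoeff_ev_eq {k : ℕ} (hk : 2 * k ≤ n) (F : Finset (Fin n) → ℝ) :
    ∃ a : Finset (Fin n) → ℝ, HarmCoeff a ∧ (∀ S, k < #S → a S = 0) ∧
      ∀ A, #A = k → ev a A = F A := by
  let Ψ : (Finset (Fin n) → ℝ) →ₗ[ℝ] (Finset (Fin n) → ℝ) :=
    { toFun := fun a S => if #S < k then ∑ j ∈ Sᶜ, a (insert j S) else
        if #S = k then ev a S else a S
      map_add' := by
        intro a b; funext S
        simp only [Pi.add_apply, ev]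
        split_ifs
        · exact sum_add_distrib
        · rw [← sum_add_distrib]
          refine sum_congr rfl fun R _ => ?_
          split_ifs <;> simp
        · rfl
      map_smul' := by
        intro c a; funext S
        simp only [Pi.smul_apply, smul_eq_mul, ev, RingHom.id_apply]
        split_ifs
        · rw [mul_sum]
        · rw [mul_sum]
          refine sum_congr rfl fun R _ => ?_
          split_ifs <;> simp
        · rfl }
  have hΨ : ∀ a S, Ψ a S = if #S < k then ∑ j ∈ Sᶜ, a (insert j S) else
        if #S = k then ev a S else a S := fun a S => rfl
  have harm : ∀ a, (∀ S, #S < k → Ψ a S = 0) → (∀ S, k < #S → Ψ a S = 0) →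
      HarmCoeff a ∧ ∀ S, k < #S → a S = 0 := by
    intro a h1 h2
    have h3 : ∀ S, k < #S → a S = 0 := by
      intro S hS
      have := h2 S hS
      rwa [hΨ, if_neg (by omega), if_neg (by omega)] at this
    refine ⟨fun R => ?_, h3⟩
    by_cases hR : #R < k
    · have := h1 R hR
      rwa [hΨ, if_pos hR] at this
    · refine sum_eq_zero fun j hj => h3 _ ?_
      rw [card_insert_of_notMem (mem_compl.1 hj)]; omega
  have hinj : Function.Injective Ψ := by
    rw [← LinearMap.ker_eq_bot, LinearMap.ker_eq_bot']
    intro a ha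
    obtain ⟨h1, h2⟩ := harm a (fun S _ => by rw [ha]; rfl) (fun S _ => by rw [ha]; rfl)
    refine h1.eq_zero_of_ev_eq_zero hk h2 fun A hA => ?_
    have : Ψ a A = 0 := by rw [ha]; rfl
    rwa [hΨ, if_neg (by omega), if_pos hA] at this
  obtain ⟨a, ha⟩ := (LinearMap.injective_iff_surjective.1 hinj) fun S => if #S = k then F S else 0
  obtain ⟨h1, h2⟩ := harm a (fun S hS => by rw [ha]; simp [hS.ne])
    (fun S hS => by rw [ha]; simp [hS.ne'])
  refine ⟨a, h1, h2, fun A hA => ?_⟩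
  have : Ψ a A = F A := by rw [ha]; simp [hA]
  rwa [hΨ, if_neg (by omega), if_pos hA] at this

end harm

/-! ### Multilinear and harmonic polynomials -/

open MvPolynomial

/-- The exponent vector of the squarefree monomial `x_S`. -/
noncomputable def sqf {n : ℕ} (S : Finset (Fin n)) : Fin n →₀ ℕ :=
  Finsupp.equivFunOnFinite.symm fun i => if i ∈ S then 1 else 0

/-- The coefficients of the squarefree monomials of `f`. -/
noncomputable def sqfCoeff {n : ℕ} (f : MvPolynomial (Fin n) ℝ) (S : Finset (Fin n)) : ℝ :=
  coeff (sqf S) f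

/-- The multilinear polynomial `∑_S a_S x_S`. -/
noncomputable def ofCoeff {n : ℕ} (a : Finset (Fin n) → ℝ) : MvPolynomial (Fin n) ℝ :=
  ∑ S, monomial (sqf S) (a S)

section poly
variable {n : ℕ} {f g : MvPolynomial (Fin n) ℝ}

@[simp] theorem sqf_apply (S : Finset (Fin n)) (i : Fin n) : sqf S i = if i ∈ S then 1 else 0 := rfl

theorem sqf_injective : Function.Injective (sqf (n := n)) := by
  intro S T h
  ext i
  have := DFunLike.congr_fun h i
  rw [sqf_apply, sqf_apply] at this
  by_cases h1 : i ∈ S <;> by_cases h2 : i ∈ T <;> simp [h1, h2] at this ⊢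

theorem degree_sqf (S : Finset (Fin n)) : Finsupp.degree (sqf S) = #S := by
  rw [Finsupp.degree_eq_sum]; simp

theorem sqf_add_single {S : Finset (Fin n)} {i : Fin n} (h : i ∉ S) :
    sqf S + Finsupp.single i 1 = sqf (insert i S) := by
  ext j
  simp only [Finsupp.add_apply, sqf_apply, mem_insert, Finsupp.single_apply]
  by_cases hj : j = i
  · subst hj; simp [h]
  · simp [hj, Ne.symm hj]

theorem exists_eq_sqf {m : Fin n →₀ ℕ} (h : ∀ i, m i ≤ 1) : ∃ S, m = sqf S := by
  refine ⟨m.support, ?_⟩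
  ext i
  have := h i
  rw [sqf_apply]
  split_ifs with h1
  · rw [Finsupp.mem_support_iff] at h1; omega
  · rwa [Finsupp.notMem_support_iff] at h1

theorem isMultilinear_iff : IsMultilinear f ↔ ∀ m i, 2 ≤ m i → coeff m f = 0 := by
  constructor
  · intro h m i hm
    have h1 := congrArg (coeff (m - Finsupp.single i 2)) (h i)
    rw [coeff_pderiv, coeff_pderiv, coeff_zero, add_assoc, ← Finsupp.single_add,
      tsub_add_cancel_of_le (by simpa using hm)] at h1
    refine (mul_eq_zero.1 ((mul_eq_zero.1 h1).resolve_right ?_)).resolve_right ?_ <;> positivity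
  · intro h i
    ext m
    rw [coeff_pderiv, coeff_pderiv, coeff_zero, h _ i (by simp)]
    ring

theorem IsMultilinear.C_mul (hf : IsMultilinear f) (c : ℝ) : IsMultilinear (C c * f) :=
  fun i => by rw [pderiv_C_mul, pderiv_C_mul, hf i, mul_zero]

theorem IsMultilinear.sum {ι : Type*} {I : Finset ι} {F : ι → MvPolynomial (Fin n) ℝ}
    (h : ∀ i ∈ I, IsMultilinear (F i)) : IsMultilinear (∑ i ∈ I, F i) :=
  fun j => by rw [map_sum, map_sum]; exact sum_eq_zero fun i hi => h i hi j

theorem isMultilinear_monomial (S : Finset (Fin n)) (c : ℝ) :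
    IsMultilinear (monomial (sqf S) c) := by
  rw [isMultilinear_iff]
  intro m i hm
  rw [coeff_monomial, if_neg]
  rintro rfl
  rw [sqf_apply] at hm
  split_ifs at hm <;> omega

theorem IsHarmonic.sub (hf : IsHarmonic f) (hg : IsHarmonic g) : IsHarmonic (f - g) := by
  unfold IsHarmonic at *
  simp only [map_sub, sum_sub_distrib, hf, hg, sub_zero]

theorem IsMultilinear.sub (hf : IsMultilinear f) (hg : IsMultilinear g) : IsMultilinear (f - g) :=
  fun i => by rw [map_sub, map_sub, hf i, hg i, sub_zero]

theorem IsHarmonic.mul (hf : IsHarmonic f) (hg : IsHarmonic g) : IsHarmonic (f * g) := by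
  unfold IsHarmonic at *
  simp only [Derivation.leibniz, smul_eq_mul, sum_add_distrib, ← mul_sum, hf, hg]
  simp

theorem isHarmonic_C (c : ℝ) : IsHarmonic (C c : MvPolynomial (Fin n) ℝ) := by
  simp [IsHarmonic]

theorem IsHarmonic.sum {ι : Type*} {I : Finset ι} {F : ι → MvPolynomial (Fin n) ℝ}
    (h : ∀ i ∈ I, IsHarmonic (F i)) : IsHarmonic (∑ i ∈ I, F i) := by
  classical
  unfold IsHarmonic at *
  simp only [map_sum]
  rw [sum_comm]
  exact sum_eq_zero h

theorem IsHarmonic.prod {ι : Type*} {I : Finset ι} {F : ι → MvPolynomial (Fin n) ℝ}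
    (h : ∀ i ∈ I, IsHarmonic (F i)) : IsHarmonic (∏ i ∈ I, F i) := by
  classical
  induction I using Finset.induction_on with
  | empty => rw [prod_empty]; exact isHarmonic_C 1
  | insert i I hi ih =>
    rw [prod_insert hi]
    exact (h i (mem_insert_self _ _)).mul (ih fun j hj => h j (mem_insert_of_mem hj))

theorem isHarmonic_X_sub_X (i j : Fin n) :
    IsHarmonic (X i - X j : MvPolynomial (Fin n) ℝ) := by
  simp [IsHarmonic, pderiv_X, sum_sub_distrib, Pi.single_apply]

theorem IsMultilinear.eq_ofCoeff (hf : IsMultilinear f) : f = ofCoeff (sqfCoeff f) := by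
  ext m
  rw [ofCoeff, coeff_sum]
  simp only [coeff_monomial]
  by_cases hm : ∀ i, m i ≤ 1
  · obtain ⟨S, rfl⟩ := exists_eq_sqf hm
    simp [sqf_injective.eq_iff, sqfCoeff]
  · push Not at hm
    obtain ⟨i, hi⟩ := hm
    rw [isMultilinear_iff.1 hf m i hi, sum_eq_zero]
    intro S _
    rw [if_neg]
    rintro rfl
    rw [sqf_apply] at hi
    split_ifs at hi <;> omega

theorem sqfCoeff_ofCoeff (a : Finset (Fin n) → ℝ) : sqfCoeff (ofCoeff a) = a := by
  funext S
  simp [sqfCoeff, ofCoeff, coeff_sum, coeff_monomial, sqf_injective.eq_iff]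

theorem isMultilinear_ofCoeff (a : Finset (Fin n) → ℝ) : IsMultilinear (ofCoeff a) :=
  IsMultilinear.sum fun _ _ => isMultilinear_monomial _ _

theorem monomial_sqf (S : Finset (Fin n)) (c : ℝ) :
    monomial (sqf S) c = C c * ∏ i ∈ S, (X i : MvPolynomial (Fin n) ℝ) := by
  rw [monomial_eq, Finsupp.prod_fintype _ _ (fun i => pow_zero _)]
  congr 1
  simp only [sqf_apply, pow_ite, pow_one, pow_zero, prod_ite_mem, univ_inter]

theorem eval_ind_ofCoeff (a : Finset (Fin n) → ℝ) (A : Finset (Fin n)) :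
    eval (ind A) (ofCoeff a) = ev a A := by
  rw [ofCoeff, map_sum, ev]
  refine sum_congr rfl fun S _ => ?_
  rw [monomial_sqf, map_mul, eval_C, map_prod]
  simp only [eval_X, ind]
  split_ifs with h
  · rw [prod_congr rfl (fun i hi => if_pos (h hi)), prod_const_one, mul_one]
  · obtain ⟨i, hi, hiA⟩ := not_subset.1 h
    rw [prod_eq_zero hi (if_neg hiA), mul_zero]

theorem IsMultilinear.eval_ind (hf : IsMultilinear f) (A : Finset (Fin n)) :
    eval (ind A) f = ev (sqfCoeff f) A := by
  conv_lhs => rw [hf.eq_ofCoeff]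
  exact eval_ind_ofCoeff _ _

theorem coeff_sqf_sum_pderiv (hf : IsMultilinear f) (R : Finset (Fin n)) :
    coeff (sqf R) (∑ i, pderiv i f) = ∑ j ∈ Rᶜ, sqfCoeff f (insert j R) := by
  rw [coeff_sum, ← sum_add_sum_compl R]
  rw [sum_eq_zero, zero_add]
  · refine sum_congr rfl fun i hi => ?_
    rw [mem_compl] at hi
    rw [coeff_pderiv, sqf_add_single hi, sqf_apply, if_neg hi, sqfCoeff]
    simp
  · intro i hi
    rw [coeff_pderiv, isMultilinear_iff.1 hf _ i, zero_mul]
    simp [hi]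

theorem IsHarmonic.harmCoeff (hf : IsMultilinear f) (h : IsHarmonic f) :
    HarmCoeff (sqfCoeff f) := by
  intro R
  rw [← coeff_sqf_sum_pderiv hf, h, coeff_zero]

theorem HarmCoeff.isHarmonic {a : Finset (Fin n) → ℝ} (h : HarmCoeff a) :
    IsHarmonic (ofCoeff a) := by
  ext m
  rw [coeff_zero]
  by_cases hm : ∀ i, m i ≤ 1
  · obtain ⟨R, rfl⟩ := exists_eq_sqf hm
    rw [coeff_sqf_sum_pderiv (isMultilinear_ofCoeff a), sqfCoeff_ofCoeff, h R]
  · push Not at hm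
    obtain ⟨i, hi⟩ := hm
    rw [coeff_sum]
    refine sum_eq_zero fun j _ => ?_
    rw [coeff_pderiv, isMultilinear_iff.1 (isMultilinear_ofCoeff a) _ i, zero_mul]
    rw [Finsupp.add_apply]; omega

theorem totalDegree_ofCoeff_le {a : Finset (Fin n) → ℝ} {k : ℕ} (h : ∀ S, k < #S → a S = 0) :
    (ofCoeff a).totalDegree ≤ k := by
  refine (totalDegree_finsetSum _ _).trans (Finset.sup_le fun S _ => ?_)
  by_cases hS : k < #S
  · rw [h S hS]; simp
  · refine (totalDegree_monomial_le _ _).trans ?_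
    have := degree_sqf S
    rw [Finsupp.degree_eq_sum] at this
    rw [Finsupp.sum_fintype _ _ (fun _ => rfl)]
    simp only [id]
    omega

theorem sqfCoeff_eq_zero {S : Finset (Fin n)} (h : f.totalDegree < #S) : sqfCoeff f S = 0 := by
  refine coeff_eq_zero_of_totalDegree_lt ?_
  rwa [← Finsupp.degree_apply, degree_sqf]

theorem sqfCoeff_homogeneousComponent (l : ℕ) (f : MvPolynomial (Fin n) ℝ) :
    sqfCoeff (homogeneousComponent l f) = levelOf l (sqfCoeff f) := by
  funext S
  rw [sqfCoeff, coeff_homogeneousComponent, degree_sqf, levelOf, levelMul, sqfCoeff]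
  split_ifs <;> ring

theorem IsMultilinear.homogeneousComponent (hf : IsMultilinear f) (l : ℕ) :
    IsMultilinear (homogeneousComponent l f) := by
  rw [isMultilinear_iff] at *
  intro m i hm
  rw [coeff_homogeneousComponent, hf m i hm, ite_self]

theorem isMultilinear_sliceNoiseOp (hf : IsMultilinear f) (ρ : ℝ) :
    IsMultilinear (sliceNoiseOp ρ f) :=
  IsMultilinear.sum fun _ _ => (hf.homogeneousComponent _).C_mul _

theorem sqfCoeff_sliceNoiseOp (ρ : ℝ) (f : MvPolynomial (Fin n) ℝ) :
    sqfCoeff (sliceNoiseOp ρ f) = levelMul (fun i => ρ ^ i) (sqfCoeff f) := by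
  funext S
  rw [sqfCoeff, sliceNoiseOp, coeff_sum]
  simp only [coeff_C_mul, coeff_homogeneousComponent, degree_sqf, mul_ite, mul_zero, sum_ite_eq,
    mem_range, levelMul]
  split_ifs with h
  · rfl
  · rw [sqfCoeff_eq_zero (by omega), mul_zero]

theorem ind_mem_slice {k : ℕ} {A : Finset (Fin n)} (hA : #A = k) : ind A ∈ slice n k := by
  refine ⟨fun i => ?_, ?_⟩
  · by_cases h : i ∈ A <;> simp [ind, h]
  · simp [ind, hA]

theorem exists_eq_ind {k : ℕ} {x : Fin n → ℝ} (h : x ∈ slice n k) :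
    ∃ A : Finset (Fin n), #A = k ∧ ind A = x := by
  obtain ⟨hx, hs⟩ := h
  have e : ind ({i | x i = 1} : Finset (Fin n)) = x := by
    funext i
    rcases hx i with h | h <;> simp [ind, h]
  refine ⟨_, ?_, e⟩
  rw [← e] at hs
  simp only [ind, sum_boole] at hs
  simpa [ind] using hs

/-- Existence and uniqueness of the harmonic projection. -/
theorem existsUnique_isHarmonicProjection {k : ℕ} (hk : 2 * k ≤ n)
    (f : MvPolynomial (Fin n) ℝ) : ∃! g, IsHarmonicProjection k f g := by
  have hmin : min k (n - k) = k := by omega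
  obtain ⟨a, h1, h2, h3⟩ := exists_harmCoeff_ev_eq hk fun A => eval (ind A) f
  refine ⟨ofCoeff a, ⟨isMultilinear_ofCoeff a, h1.isHarmonic, ?_, ?_⟩, ?_⟩
  · rw [hmin]; exact totalDegree_ofCoeff_le h2
  · intro x hx
    obtain ⟨A, hA, rfl⟩ := exists_eq_ind hx
    rw [eval_ind_ofCoeff, h3 A hA]
  · intro g hg
    have hd : IsMultilinear (g - ofCoeff a) := hg.multilinear.sub (isMultilinear_ofCoeff a)
    have hz : sqfCoeff (g - ofCoeff a) = 0 := by
      refine (IsHarmonic.harmCoeff hd (hg.harmonic.sub h1.isHarmonic)).eq_zero_of_ev_eq_zero hk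
        ?_ ?_
      · intro S hS
        refine sqfCoeff_eq_zero (lt_of_le_of_lt (totalDegree_sub _ _) ?_)
        have := hg.degree_le
        have h4 := totalDegree_ofCoeff_le h2
        rw [max_lt_iff]; omega
      · intro A hA
        rw [← hd.eval_ind, map_sub, eval_ind_ofCoeff, h3 A hA, hg.agrees _ (ind_mem_slice hA),
          sub_self]
    have h5 := hd.eq_ofCoeff
    rw [hz] at h5
    rw [← sub_eq_zero, h5]
    simp [ofCoeff]

theorem eval_character (p : ℝ) (S : Finset (Fin n)) (x : Fin n → ℝ) :
    eval x (character p S) = chi p x S := by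
  simp [character, chi, normCoord, map_prod]

/-- Expanding `x_i = √(p q) w_i + p` in the monomials of `f` gives its Fourier expansion, with
no character that involves a new variable or exceeds the degree of `f`. -/
theorem IsMultilinear.exists_fourier_expansion (hf : IsMultilinear f) {p : ℝ} (hp0 : 0 < p)
    (hp1 : p < 1) : ∃ b : Finset (Fin n) → ℝ, (∀ S, ¬ S ⊆ f.vars → b S = 0) ∧
      (∀ S, f.totalDegree < #S → b S = 0) ∧ f = ∑ S, C (b S) * character p S := by
  set s := √(p * (1 - p)) with hs
  have hs0 : s ≠ 0 := (Real.sqrt_pos.2 (mul_pos hp0 (by linarith))).ne'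
  have hX : ∀ i, (X i : MvPolynomial (Fin n) ℝ) = C s * (C (1 / s) * (X i - C p)) + C p := by
    intro i
    rw [← mul_assoc, ← map_mul, mul_one_div_cancel hs0, map_one]; ring
  have hmon : ∀ S : Finset (Fin n), ∏ i ∈ S, (X i : MvPolynomial (Fin n) ℝ) =
      ∑ R, C (if R ⊆ S then s ^ #R * p ^ #(S \ R) else 0) * character p R := by
    intro S
    rw [prod_congr rfl fun i _ => hX i, prod_add, ← sum_subset (subset_univ S.powerset)]
    · refine sum_congr rfl fun R hR => ?_
      rw [if_pos (mem_powerset.1 hR), prod_mul_distrib, prod_const, prod_const, character, map_mul,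
        map_pow, map_pow]
      ring
    · intro R _ hR
      rw [if_neg (by simpa using hR)]; simp
  refine ⟨fun R => ∑ S, if R ⊆ S then sqfCoeff f S * (s ^ #R * p ^ #(S \ R)) else 0, ?_, ?_, ?_⟩
  · intro R hR
    refine sum_eq_zero fun S _ => ?_
    split_ifs with h
    · have : sqfCoeff f S = 0 := by
        by_contra hne
        refine hR (h.trans fun i hi => ?_)
        rw [mem_vars_iff_mem_support]
        exact ⟨sqf S, mem_support_iff.2 hne, by simp [Finsupp.mem_support_iff, hi]⟩
      rw [this, zero_mul]
    · rfl
  · intro R hR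
    refine sum_eq_zero fun S _ => ?_
    split_ifs with h
    · rw [sqfCoeff_eq_zero (hR.trans_le (card_le_card h)), zero_mul]
    · rfl
  · conv_lhs => rw [hf.eq_ofCoeff, ofCoeff]
    simp only [monomial_sqf, hmon, map_sum, sum_mul, mul_sum]
    rw [sum_comm]
    refine sum_congr rfl fun R _ => sum_congr rfl fun S _ => ?_
    split_ifs
    · simp only [map_mul]; ring
    · simp

/-- The harmonic polynomial obtained from `∑_{S ⊆ D} b_S ω_S` by averaging, over `r`, the
substitutions `w_i ↦ w_i - w_{τ r i}` of the normalised coordinates. -/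
noncomputable def swapAvg {m : ℕ} (p : ℝ) (D : Finset (Fin n)) (τ : Fin m → Fin n → Fin n)
    (b : Finset (Fin n) → ℝ) : MvPolynomial (Fin n) ℝ :=
  ∑ S ∈ D.powerset, C (b S) * ∑ r, C (1 / (m : ℝ)) *
    ∏ i ∈ S, (C (1 / √(p * (1 - p))) * (X i - X (τ r i)))

section swapAvg
variable {m : ℕ} {D : Finset (Fin n)} {τ : Fin m → Fin n → Fin n} {p : ℝ}

theorem isHarmonic_swapAvg (b : Finset (Fin n) → ℝ) : IsHarmonic (swapAvg p D τ b) :=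
  IsHarmonic.sum fun _ _ => (isHarmonic_C _).mul <| IsHarmonic.sum fun _ _ =>
    (isHarmonic_C _).mul <| IsHarmonic.prod fun _ _ => (isHarmonic_C _).mul (isHarmonic_X_sub_X _ _)

theorem IsSwapFamily.isMultilinear_swapAvg (h : IsSwapFamily D τ) (b : Finset (Fin n) → ℝ) :
    IsMultilinear (swapAvg p D τ b) := by
  refine IsMultilinear.sum fun S hS => IsMultilinear.C_mul
    (IsMultilinear.sum fun r _ => IsMultilinear.C_mul ?_ _) _
  rw [mem_powerset] at hS
  rw [prod_mul_distrib, prod_const, ← map_pow]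
  refine IsMultilinear.C_mul ?_ _
  rw [prod_sub_comp_eq (v := fun i => (X i : MvPolynomial (Fin n) ℝ))
    (fun i hi j hj e => (h.inj r r i (hS hi) j (hS hj) e).2)
    (fun i hi hc => h.notMem r i (hS hi) (hS hc))]
  refine IsMultilinear.sum fun P _ => ?_
  have e : (-1 : MvPolynomial (Fin n) ℝ) ^ #P = C ((-1) ^ #P) := by simp
  rw [e, ← monomial_sqf]
  exact isMultilinear_monomial _ _

theorem sqfCoeff_swapAvg_levelMul (c : ℕ → ℝ) (b : Finset (Fin n) → ℝ) :
    sqfCoeff (swapAvg p D τ (levelMul c b)) = levelMul c (sqfCoeff (swapAvg p D τ b)) := by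
  funext U
  simp only [sqfCoeff, levelMul, swapAvg, coeff_sum, coeff_C_mul, mul_sum]
  refine sum_congr rfl fun S _ => sum_congr rfl fun r _ => ?_
  by_cases hc : #S = #U
  · rw [hc]; ring
  · have hh : (∏ i ∈ S, (C (1 / √(p * (1 - p))) * (X i - X (τ r i) : MvPolynomial (Fin n) ℝ)
        )).IsHomogeneous (∑ i ∈ S, (0 + 1)) :=
      IsHomogeneous.prod _ _ _ fun i _ => (isHomogeneous_C _ _).mul
        ((isHomogeneous_X _ _).sub (isHomogeneous_X _ _))
    rw [hh.coeff_eq_zero (d := sqf U)]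
    · ring
    · rw [degree_sqf]; simpa using Ne.symm hc

theorem eval_swapAvg_sub (hm : 0 < m) (b : Finset (Fin n) → ℝ) (A : Finset (Fin n)) :
    eval (ind A) (swapAvg p D τ b) - ∑ S ∈ D.powerset, b S * chi p (ind A) S =
      1 / (m : ℝ) * ∑ r, swapDiff p D (τ r) b A := by
  have hm' : (m : ℝ) ≠ 0 := by positivity
  simp only [swapAvg, swapDiff, map_sum, map_mul, eval_C, map_prod, map_sub, eval_X]
  rw [sum_comm (s := univ), mul_sum, ← sum_sub_distrib]
  refine sum_congr rfl fun S _ => ?_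
  rw [← mul_sum _ _ (b S), sum_sub_distrib, sum_const, card_univ, Fintype.card_fin, nsmul_eq_mul,
    ← mul_sum]
  have e : ∀ i r, 1 / √(p * (1 - p)) * (ind A i - ind A (τ r i)) =
      normCoord p (ind A i) - normCoord p (ind A (τ r i)) := fun i r => by
    simp only [normCoord]; ring
  simp only [e]
  field_simp

end swapAvg

end poly

/-! ### Expectations under the slice, cube and Gaussian measures -/

section expectations

open MeasureTheory ProbabilityTheory

section sliceMeasure
variable {n k : ℕ}

theorem ind_injective : Function.Injective (ind (n := n)) := by
  intro A B h
  ext i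
  have := congrFun h i
  by_cases h1 : i ∈ A <;> by_cases h2 : i ∈ B <;> simp [ind, h1, h2] at this ⊢

theorem slice_eq_image (n k : ℕ) :
    slice n k = ↑((powersetCard k (univ : Finset (Fin n))).image ind) := by
  ext x
  simp only [coe_image, Set.mem_image, mem_coe, mem_powersetCard, subset_univ, true_and]
  exact ⟨exists_eq_ind, fun ⟨A, hA, e⟩ => e ▸ ind_mem_slice hA⟩

theorem integral_sliceMeasure (n k : ℕ) (φ : (Fin n → ℝ) → ℝ) :
    ∫ x, φ x ∂sliceMeasure n k = wsum (sliceW n k) fun A => φ (ind A) := by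
  have hc : #((powersetCard k (univ : Finset (Fin n))).image ind) = n.choose k := by
    rw [card_image_of_injective _ ind_injective, card_powersetCard, card_univ, Fintype.card_fin]
  rw [sliceMeasure, uniformOn, ProbabilityTheory.cond, integral_smul_measure, slice_eq_image,
    setIntegral_finset, Measure.count_apply_finset, hc,
    sum_image ind_injective.injOn, wsum, ENNReal.toReal_inv, ENNReal.toReal_natCast, smul_eq_mul,
    mul_sum, ← sum_subset (subset_univ (powersetCard k (univ : Finset (Fin n))))]
  · refine sum_congr rfl fun A hA => ?_
    rw [sliceW, if_pos (mem_powersetCard.1 hA).2]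
    simp [Measure.real]
  · intro A _ hA
    rw [sliceW, if_neg (by simpa using hA), zero_mul]
  · rw [← Set.biUnion_of_singleton (↑(image ind (powersetCard k (univ : Finset (Fin n)))) :
      Set (Fin n → ℝ))]
    exact integrableOn_finset_iUnion.2 fun x _ => integrableOn_singleton (by simp) (by simp)

theorem wsum_sliceW_const (hk : k ≤ n) (c : ℝ) : (wsum (sliceW n k) fun _ => c) = c := by
  have h := wsum_sliceW_subset (n := n) k ∅
  have h0 : (n.choose k : ℝ) ≠ 0 := by exact_mod_cast (Nat.choose_pos hk).ne'
  simp only [empty_subset, if_true, containProb, card_empty, Nat.zero_le, Nat.sub_zero,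
    div_self h0] at h
  have := wsum_mul_left (w := sliceW n k) c (fun _ => (1 : ℝ))
  rw [h] at this
  simpa using this

theorem expect_sliceMeasure (f : MvPolynomial (Fin n) ℝ) :
    expect (sliceMeasure n k) f = wsum (sliceW n k) fun A => eval (ind A) f :=
  integral_sliceMeasure n k _

theorem l2norm_sliceMeasure (f : MvPolynomial (Fin n) ℝ) :
    l2norm (sliceMeasure n k) f = √(wsum (sliceW n k) fun A => eval (ind A) f ^ 2) := by
  simp only [l2norm, expect_sliceMeasure, map_pow]

theorem aemeasurable_eval (f : MvPolynomial (Fin n) ℝ) (π : Measure (Fin n → ℝ)) :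
    AEMeasurable (fun x => eval x f) π :=
  (MvPolynomial.continuous_eval f).measurable.aemeasurable

theorem var_sliceMeasure (hk : k ≤ n) (f : MvPolynomial (Fin n) ℝ) :
    var (sliceMeasure n k) f = (wsum (sliceW n k) fun A => eval (ind A) f ^ 2) -
      (wsum (sliceW n k) fun A => eval (ind A) f) ^ 2 := by
  rw [var, variance_eq_integral (aemeasurable_eval f _), integral_sliceMeasure,
    integral_sliceMeasure]
  set m := wsum (sliceW n k) fun A => eval (ind A) f with hm
  have e : (fun A : Finset (Fin n) => (eval (ind A) f - m) ^ 2) =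
      fun A => (eval (ind A) f ^ 2 - 2 * m * eval (ind A) f) + m ^ 2 := by
    funext A; ring
  rw [e, wsum_add, wsum_sub, wsum_mul_left, wsum_sliceW_const hk, ← hm]
  ring

end sliceMeasure

/-- Probability measures on `ℝ` for which `(y - p) / √(p (1 - p))` has mean `0` and variance `1`.
The Bernoulli and the normal distribution enter the argument only through these properties. -/
structure IsNormalisedBy (p : ℝ) (m : Measure ℝ) : Prop where
  prob : IsProbabilityMeasure m
  integrable : Integrable (normCoord p) m
  integrable_sq : Integrable (fun y => normCoord p y * normCoord p y) m
  integral_eq : ∫ y, normCoord p y ∂m = 0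
  integral_sq_eq : ∫ y, normCoord p y * normCoord p y ∂m = 1

section normalised
variable {n : ℕ} {p : ℝ}

theorem isNormalisedBy_bernoulli (hp0 : 0 < p) (hp1 : p < 1) :
    IsNormalisedBy p (ENNReal.ofReal (1 - p) • Measure.dirac (0 : ℝ) +
      ENNReal.ofReal p • Measure.dirac (1 : ℝ)) := by
  have hq : 0 < 1 - p := by linarith
  have hint : ∀ u : ℝ → ℝ, Integrable u (ENNReal.ofReal (1 - p) • Measure.dirac (0 : ℝ)) ∧
      Integrable u (ENNReal.ofReal p • Measure.dirac (1 : ℝ)) := fun u =>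
    ⟨(integrable_dirac (by simp)).smul_measure (by simp),
      (integrable_dirac (by simp)).smul_measure (by simp)⟩
  have hval : ∀ u : ℝ → ℝ, ∫ y, u y ∂(ENNReal.ofReal (1 - p) • Measure.dirac (0 : ℝ) +
      ENNReal.ofReal p • Measure.dirac (1 : ℝ)) = (1 - p) * u 0 + p * u 1 := by
    intro u
    rw [integral_add_measure (hint u).1 (hint u).2, integral_smul_measure, integral_smul_measure,
      integral_dirac, integral_dirac, ENNReal.toReal_ofReal hq.le, ENNReal.toReal_ofReal hp0.le,
      smul_eq_mul, smul_eq_mul]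
  have hs : (√(p * (1 - p))) ^ 2 = p * (1 - p) := Real.sq_sqrt (by positivity)
  have hs0 : √(p * (1 - p)) ≠ 0 := (Real.sqrt_pos.2 (by positivity)).ne'
  refine ⟨⟨?_⟩, (hint _).1.add_measure (hint _).2, (hint _).1.add_measure (hint _).2, ?_, ?_⟩
  · simp only [Measure.coe_add, Measure.coe_smul, Pi.add_apply, Pi.smul_apply, measure_univ,
      smul_eq_mul, mul_one]
    rw [← ENNReal.ofReal_add hq.le hp0.le]; simp
  · rw [hval]; simp only [normCoord]; ring
  · rw [hval]; simp only [normCoord]; field_simp; rw [hs]; ring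

theorem isNormalisedBy_gaussian (hp0 : 0 < p) (hp1 : p < 1) :
    IsNormalisedBy p (gaussianReal p (p * (1 - p)).toNNReal) := by
  have hq : 0 < 1 - p := by linarith
  have hs : (√(p * (1 - p))) ^ 2 = p * (1 - p) := Real.sq_sqrt (by positivity)
  have hs0 : √(p * (1 - p)) ≠ 0 := (Real.sqrt_pos.2 (by positivity)).ne'
  have hid : MemLp id 2 (gaussianReal p (p * (1 - p)).toNNReal) := by
    exact_mod_cast memLp_id_gaussianReal 2
  have hw : MemLp (normCoord p) 2 (gaussianReal p (p * (1 - p)).toNNReal) :=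
    (hid.sub (memLp_const p)).const_mul (1 / √(p * (1 - p)))
  refine ⟨inferInstance, hw.integrable (by norm_num), ?_, ?_, ?_⟩
  · simpa [sq] using hw.integrable_sq
  · simp only [normCoord]
    rw [integral_const_mul, integral_sub, integral_id_gaussianReal, integral_const]
    · simp
    · exact hid.integrable (by norm_num)
    · exact integrable_const p
  · have hv := variance_id_gaussianReal (μ := p) (v := (p * (1 - p)).toNNReal)
    rw [variance_eq_integral aemeasurable_id] at hv
    simp only [id, integral_id_gaussianReal, Real.coe_toNNReal _ (by positivity : 0 ≤ p * (1 - p))]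
      at hv
    have e : (fun y => normCoord p y * normCoord p y) =
        fun y => (1 / √(p * (1 - p))) ^ 2 * (y - p) ^ 2 := by
      funext y; simp only [normCoord]; ring
    rw [e, integral_const_mul, hv, div_pow, hs]
    field_simp

variable {m : Measure ℝ}

theorem IsNormalisedBy.chi_mul_chi_integral (h : IsNormalisedBy p m) (S T : Finset (Fin n)) :
    Integrable (fun x => chi p x S * chi p x T) (Measure.pi fun _ : Fin n => m) ∧
    ∫ x, chi p x S * chi p x T ∂(Measure.pi fun _ : Fin n => m) = if S = T then 1 else 0 := by
  have := h.prob
  have hi : ∀ i : Fin n, Integrable (fun y => (if i ∈ S then normCoord p y else 1) *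
      (if i ∈ T then normCoord p y else 1)) m := by
    intro i
    by_cases h1 : i ∈ S <;> by_cases h2 : i ∈ T <;>
      simp [h1, h2, h.integrable, h.integrable_sq]
  simp only [chi_mul_chi]
  refine ⟨Integrable.fintype_prod (f := fun i y => (if i ∈ S then normCoord p y else 1) *
      (if i ∈ T then normCoord p y else 1)) hi, ?_⟩
  rw [integral_fintype_prod_eq_prod (fun i y => (if i ∈ S then normCoord p y else 1) *
      (if i ∈ T then normCoord p y else 1)), ← prod_ite_mem_iff]
  refine prod_congr rfl fun i _ => ?_
  by_cases h1 : i ∈ S <;> by_cases h2 : i ∈ T <;>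
    simp [h1, h2, h.integral_eq, h.integral_sq_eq]

theorem eval_sum_character (b : Finset (Fin n) → ℝ) (x : Fin n → ℝ) :
    eval x (∑ S, C (b S) * character p S) = ∑ S, b S * chi p x S := by
  simp only [map_sum, map_mul, eval_C, eval_character]

theorem IsNormalisedBy.expect_mul (h : IsNormalisedBy p m) (a b : Finset (Fin n) → ℝ) :
    expect (Measure.pi fun _ : Fin n => m)
      ((∑ S, C (a S) * character p S) * ∑ S, C (b S) * character p S) = ∑ S, a S * b S := by
  rw [expect]
  have e : ∀ x : Fin n → ℝ, eval x ((∑ S, C (a S) * character p S) *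
      ∑ S, C (b S) * character p S) = ∑ S, ∑ T, a S * b T * (chi p x S * chi p x T) := by
    intro x
    rw [map_mul, eval_sum_character, eval_sum_character, sum_mul_sum]
    exact sum_congr rfl fun S _ => sum_congr rfl fun T _ => by ring
  simp only [e]
  rw [integral_finsetSum _ fun S _ => integrable_finsetSum _ fun T _ =>
    (h.chi_mul_chi_integral S T).1.const_mul _]
  refine sum_congr rfl fun S _ => ?_
  rw [integral_finsetSum _ fun T _ => (h.chi_mul_chi_integral S T).1.const_mul _]
  simp [integral_const_mul, (h.chi_mul_chi_integral S _).2]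

theorem sum_single_character (T : Finset (Fin n)) :
    ∑ S, C (if S = T then (1 : ℝ) else 0) * character p S = character p T := by
  rw [sum_eq_single_of_mem T (mem_univ T)]
  · simp
  · intro S _ hS; simp [hS]

theorem IsNormalisedBy.expect_mul_character (h : IsNormalisedBy p m) (b : Finset (Fin n) → ℝ)
    (T : Finset (Fin n)) :
    expect (Measure.pi fun _ : Fin n => m) ((∑ S, C (b S) * character p S) * character p T) =
      b T := by
  rw [← sum_single_character T, h.expect_mul]
  simp

theorem IsNormalisedBy.expect_eq (h : IsNormalisedBy p m) (b : Finset (Fin n) → ℝ) :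
    expect (Measure.pi fun _ : Fin n => m) (∑ S, C (b S) * character p S) = b ∅ := by
  rw [← h.expect_mul_character b ∅]
  simp [character]

theorem IsNormalisedBy.l2norm_eq (h : IsNormalisedBy p m) (b : Finset (Fin n) → ℝ) :
    l2norm (Measure.pi fun _ : Fin n => m) (∑ S, C (b S) * character p S) =
      √(∑ S, b S ^ 2) := by
  rw [l2norm, sq, h.expect_mul]
  simp only [sq]

theorem IsNormalisedBy.var_eq (h : IsNormalisedBy p m) (b : Finset (Fin n) → ℝ) :
    var (Measure.pi fun _ : Fin n => m) (∑ S, C (b S) * character p S) =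
      ∑ S, b S ^ 2 - b ∅ ^ 2 := by
  rw [var, variance_eq_integral (aemeasurable_eval _ _), ← expect, h.expect_eq]
  set c : Finset (Fin n) → ℝ := fun S => if S = ∅ then 0 else b S with hc
  have e : ∑ S, C (b S) * character p S - C (b ∅) = ∑ S, C (c S) * character p S := by
    rw [← add_sum_erase _ _ (mem_univ ∅), ← add_sum_erase _ (fun S => C (c S) * _) (mem_univ ∅)]
    have : ∀ S ∈ (univ : Finset (Finset (Fin n))).erase ∅,
        C (b S) * character p S = C (c S) * character p S := by
      intro S hS; rw [hc]; simp [ne_of_mem_erase hS]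
    rw [sum_congr rfl this]
    simp [hc, character]
  have e2 : ∀ x : Fin n → ℝ, (eval x (∑ S, C (b S) * character p S) - b ∅) ^ 2 =
      eval x ((∑ S, C (c S) * character p S) * ∑ S, C (c S) * character p S) := by
    intro x
    rw [← e]; simp only [map_mul, map_sub, eval_C]; ring
  simp only [e2]
  rw [← expect, h.expect_mul, ← add_sum_erase _ _ (mem_univ ∅),
    ← add_sum_erase _ (fun S => b S ^ 2) (mem_univ ∅)]
  have : ∀ S ∈ (univ : Finset (Finset (Fin n))).erase ∅, c S * c S = b S ^ 2 := by
    intro S hS; rw [hc]; simp [ne_of_mem_erase hS, sq]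
  rw [sum_congr rfl this]
  simp [hc]

theorem fourierCoeff_sum (hp0 : 0 < p) (hp1 : p < 1) (b : Finset (Fin n) → ℝ)
    (T : Finset (Fin n)) : fourierCoeff p (∑ S, C (b S) * character p S) T = b T :=
  (isNormalisedBy_bernoulli hp0 hp1).expect_mul_character b T

theorem levelPart_sum (hp0 : 0 < p) (hp1 : p < 1) (b : Finset (Fin n) → ℝ) (l : ℕ) :
    levelPart p l (∑ S, C (b S) * character p S) = ∑ S, C (levelOf l b S) * character p S := by
  simp only [levelPart, fourierCoeff_sum hp0 hp1]
  rw [← sum_subset (subset_univ (powersetCard l (univ : Finset (Fin n))))]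
  · refine sum_congr rfl fun S hS => ?_
    simp [levelOf, levelMul, (mem_powersetCard.1 hS).2]
  · intro S _ hS
    rw [levelOf_eq_zero l b S (by simpa using hS)]; simp

theorem noiseOp_sum (hp0 : 0 < p) (hp1 : p < 1) {b : Finset (Fin n) → ℝ}
    (hb : ∀ S, (∑ S, C (b S) * character p S).totalDegree < #S → b S = 0) (ρ : ℝ) :
    noiseOp p ρ (∑ S, C (b S) * character p S) =
      ∑ S, C (levelMul (fun i => ρ ^ i) b S) * character p S := by
  simp only [noiseOp, levelPart_sum hp0 hp1, mul_sum]
  rw [sum_comm]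
  refine sum_congr rfl fun S _ => ?_
  simp only [← mul_assoc, ← map_mul]
  rw [← sum_mul, ← map_sum]
  congr 2
  by_cases hS : #S < (∑ S, C (b S) * character p S).totalDegree + 1
  · rw [sum_eq_single_of_mem #S (mem_range.2 hS)]
    · simp [levelOf, levelMul]
    · intro i _ hi
      rw [levelOf_eq_zero i b S hi.symm, mul_zero]
  · simp [levelOf, levelMul, hb S (by omega)]

theorem IsNormalisedBy.noiseStab_eq (h : IsNormalisedBy p m) (hp0 : 0 < p) (hp1 : p < 1)
    {b : Finset (Fin n) → ℝ}
    (hb : ∀ S, (∑ S, C (b S) * character p S).totalDegree < #S → b S = 0) (ρ : ℝ) :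
    noiseStab (Measure.pi fun _ : Fin n => m) p ρ (∑ S, C (b S) * character p S) =
      ∑ S, ρ ^ #S * b S ^ 2 := by
  rw [noiseStab, noiseOp_sum hp0 hp1 hb, h.expect_mul]
  exact sum_congr rfl fun S _ => by rw [levelMul]; ring

end normalised

end expectations

/-! ### Comparison of the norms -/

/-- The function `∑_S b_S ω_S` on the subsets of `[n]`. -/
noncomputable def fourierFun {n : ℕ} (p : ℝ) (b : Finset (Fin n) → ℝ) (A : Finset (Fin n)) : ℝ :=
  ∑ S, b S * chi p (ind A) S

section final
variable {n k d : ℕ} {p : ℝ} {D : Finset (Fin n)} {b : Finset (Fin n) → ℝ}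

theorem wsum_sliceW_congr {F G : Finset (Fin n) → ℝ} (h : ∀ A, #A = k → F A = G A) :
    wsum (sliceW n k) F = wsum (sliceW n k) G := by
  refine sum_congr rfl fun A _ => ?_
  by_cases hA : #A = k
  · rw [h A hA]
  · simp [sliceW, hA]

theorem wsum_sliceW_sq_le (hk : k ≤ n) (F : Finset (Fin n) → ℝ) :
    wsum (sliceW n k) F ^ 2 ≤ wsum (sliceW n k) fun A => F A ^ 2 := by
  have h := wsum_mul_sq_le (sliceW_nonneg (k := k)) F fun _ => 1
  simp only [mul_one, one_pow] at h
  rwa [wsum_sliceW_const hk, mul_one] at h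

theorem fourierFun_eq_sum_powerset (hb : ∀ S, ¬ S ⊆ D → b S = 0) (A : Finset (Fin n)) :
    fourierFun p b A = ∑ S ∈ D.powerset, b S * chi p (ind A) S := by
  refine (sum_subset (subset_univ _) fun S _ hS => ?_).symm
  rw [hb S (by simpa using hS), zero_mul]

theorem fourierFun_inter (hb : ∀ S, ¬ S ⊆ D → b S = 0) (A : Finset (Fin n)) :
    fourierFun p b A = fourierFun p b (A ∩ D) := by
  rw [fourierFun_eq_sum_powerset hb, fourierFun_eq_sum_powerset hb]
  exact sum_congr rfl fun S hS => by rw [chi_ind_inter (mem_powerset.1 hS)]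

theorem wsum_cubeW_fourierFun_sq (hp0 : 0 < p) (hp1 : p < 1) (b : Finset (Fin n) → ℝ) :
    (wsum (cubeW p) fun A => fourierFun p b A ^ 2) = ∑ S, b S ^ 2 := by
  have h := wsum_cubeW_expansion_mul hp0 hp1 univ univ b b id id
  simp only [id] at h
  simp only [sq, fourierFun]
  rw [h]
  simp

theorem wsum_cubeW_fourierFun (hp0 : 0 < p) (hp1 : p < 1) (b : Finset (Fin n) → ℝ) :
    wsum (cubeW p) (fourierFun p b) = b ∅ := by
  have h := wsum_cubeW_expansion_mul hp0 hp1 univ {∅} b (fun _ => 1) id id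
  have e : fourierFun p b = fun A => ∑ S, b S * chi p (ind A) S := rfl
  rw [e]
  simpa [chi] using h

theorem wsum_cubeW_one (hp0 : 0 < p) (hp1 : p < 1) :
    (wsum (cubeW (n := n) p) fun _ => 1) = 1 := by
  simpa [chi] using wsum_cubeW_chi_mul_chi (n := n) hp0 hp1 ∅ ∅

theorem wsum_cubeW_abs_le (hp0 : 0 < p) (hp1 : p < 1) (h1 : ∑ S, b S ^ 2 ≤ 1) :
    (wsum (cubeW p) fun A => |fourierFun p b A|) ≤ 1 := by
  have h := wsum_mul_sq_le (cubeW_nonneg hp0.le hp1.le) (fun A => |fourierFun p b A|) fun _ => 1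
  simp only [mul_one, sq_abs, one_pow] at h
  rw [wsum_cubeW_one hp0 hp1, wsum_cubeW_fourierFun_sq hp0 hp1] at h
  exact (abs_le_of_sq_le_sq' (h.trans (by linarith)) zero_le_one).2

theorem abs_sqrt_sub_sqrt_le {x y : ℝ} (hx : 0 ≤ x) (hy : 0 ≤ y) : |√x - √y| ≤ √|x - y| := by
  refine Real.le_sqrt_of_sq_le ?_
  rw [sq_abs, le_abs]
  rcases le_total (√x) (√y) with h | h
  · right; nlinarith [Real.sq_sqrt hx, Real.sq_sqrt hy, Real.sqrt_nonneg x]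
  · left; nlinarith [Real.sq_sqrt hx, Real.sq_sqrt hy, Real.sqrt_nonneg y]

theorem ev_sub (a a' : Finset (Fin n) → ℝ) (A : Finset (Fin n)) :
    ev (fun S => a S - a' S) A = ev a A - ev a' A := by
  rw [ev, ev, ev, ← sum_sub_distrib]
  refine sum_congr rfl fun S _ => ?_
  split_ifs <;> simp

/-- The error term up to a factor depending on `p`: `η = d 2^{d/2} / √(p n)`. -/
noncomputable def eta (p : ℝ) (d n : ℕ) : ℝ := errorTerm d n / √p

theorem eta_nonneg (p : ℝ) (d n : ℕ) : 0 ≤ eta p d n :=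
  div_nonneg (errorTerm_nonneg d n) (Real.sqrt_nonneg p)

theorem eta_sq (hp0 : 0 < p) (hkn : (k : ℝ) = p * n) : eta p d n ^ 2 = d ^ 2 * 2 ^ d / k := by
  have e : ((2 : ℝ) ^ ((d : ℝ) / 2)) ^ 2 = 2 ^ d := by
    rw [← Real.rpow_natCast, ← Real.rpow_mul (by norm_num), ← Real.rpow_natCast]
    congr 1; push_cast; ring
  rw [eta, errorTerm, div_pow, div_pow, mul_pow, e, Real.sq_sqrt hp0.le,
    Real.sq_sqrt (Nat.cast_nonneg n), hkn, div_div, mul_comm p]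

theorem sq_div_le_eta_sq (hp0 : 0 < p) (hkn : (k : ℝ) = p * n) :
    (d : ℝ) ^ 2 / k ≤ eta p d n ^ 2 := by
  rw [eta_sq hp0 hkn]
  gcongr
  exact le_mul_of_one_le_right (by positivity) (one_le_pow₀ (by norm_num))

theorem errorTerm_le_eta (hp0 : 0 < p) (hp1 : p ≤ 1) : errorTerm d n ≤ eta p d n := by
  rw [eta, le_div_iff₀ (Real.sqrt_pos.2 hp0)]
  exact mul_le_of_le_one_right (errorTerm_nonneg d n) (Real.sqrt_le_one.2 hp1)

theorem one_le_three_mul_eta (hn : 0 < k) (hp0 : 0 < p) (hkn : (k : ℝ) = p * n)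
    (hd : k < 9 * d ^ 2) : 1 ≤ 3 * eta p d n := by
  have hk' : (0 : ℝ) < k := by exact_mod_cast hn
  have h := sq_div_le_eta_sq (d := d) hp0 hkn
  have h2 : 1 / 9 ≤ (d : ℝ) ^ 2 / k := by
    rw [le_div_iff₀ hk']
    have : (k : ℝ) < 9 * d ^ 2 := by exact_mod_cast hd
    linarith
  have := eta_nonneg p d n
  nlinarith

section few
variable (hn : 0 < k) (hp0 : 0 < p) (hp1 : p < 1) (hkn : (k : ℝ) = p * n) (hk : 2 * k ≤ n)
  (hD : #D ≤ d) (hd : 9 * d ^ 2 ≤ k) (hb : ∀ S, ¬ S ⊆ D → b S = 0) (h1 : ∑ S, b S ^ 2 ≤ 1)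
include hn hp0 hp1 hkn hk hD hd hb h1

theorem abs_wsum_sliceW_fourierFun_sq_sub_le :
    |(wsum (sliceW n k) fun A => fourierFun p b A ^ 2) - ∑ S, b S ^ 2| ≤ (d : ℝ) ^ 2 / k := by
  have h := abs_wsum_slice_sub_cube_le (F := fun A => fourierFun p b A ^ 2) hn hkn hp0.le hp1.le hk
    hD (by omega) (fun A => by rw [fourierFun_inter hb])
  simp only [abs_sq] at h
  rw [wsum_cubeW_fourierFun_sq hp0 hp1] at h
  exact h.trans (mul_le_of_le_one_right (by positivity) h1)

theorem abs_wsum_sliceW_fourierFun_sub_le :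
    |wsum (sliceW n k) (fourierFun p b) - b ∅| ≤ (d : ℝ) ^ 2 / k := by
  have h := abs_wsum_slice_sub_cube_le (F := fourierFun p b) hn hkn hp0.le hp1.le hk
    hD (by omega) (fun A => by rw [fourierFun_inter hb])
  rw [wsum_cubeW_fourierFun hp0 hp1] at h
  exact h.trans (mul_le_of_le_one_right (by positivity) (wsum_cubeW_abs_le hp0 hp1 h1))

theorem wsum_sliceW_fourierFun_sq_le_of_few :
    (wsum (sliceW n k) fun A => fourierFun p b A ^ 2) ≤ 2 ∧ (d : ℝ) ^ 2 / k ≤ 1 ∧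
      (d : ℝ) ^ 2 / k ≤ eta p d n := by
  have hk' : (0 : ℝ) < k := by exact_mod_cast hn
  have h := abs_wsum_sliceW_fourierFun_sq_sub_le hn hp0 hp1 hkn hk hD hd hb h1
  have h2 := sq_div_le_eta_sq (d := d) hp0 hkn
  have h3 : (d : ℝ) ^ 2 / k ≤ 1 := by
    rw [div_le_one hk']; exact_mod_cast (by omega : d ^ 2 ≤ k)
  have hη := eta_nonneg p d n
  refine ⟨by linarith [(abs_le.1 h).2], h3, ?_⟩
  rcases le_total (eta p d n) 1 with h4 | h4
  · nlinarith
  · linarith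

theorem sqrt_wsum_sliceW_swapAvg_sub_le {τ : Fin (k / d + 1) → Fin n → Fin n}
    (hτ : IsSwapFamily D τ) :
    √(wsum (sliceW n k) fun A => (eval (ind A) (swapAvg p D τ b) - fourierFun p b A) ^ 2) ≤
      4 * eta p d n := by
  have h := hτ.wsum_sliceW_avg_sq_le hp0 hp1 hn hkn hk hD hd b
  have hη := eta_nonneg p d n
  have h2 : ∑ S ∈ D.powerset, b S ^ 2 ≤ 1 :=
    (sum_le_sum_of_subset_of_nonneg (subset_univ _) fun S _ _ => sq_nonneg _).trans h1
  refine Real.sqrt_le_iff.2 ⟨by positivity, ?_⟩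
  simp only [fourierFun_eq_sum_powerset hb, eval_swapAvg_sub (Nat.succ_pos (k / d))]
  refine h.trans ((mul_le_of_le_one_right (by positivity) h2).trans ?_)
  have e := eta_sq (d := d) hp0 hkn
  have e2 : (10 : ℝ) * d ^ 2 * 2 ^ d / k = 10 * eta p d n ^ 2 := by rw [e]; ring
  rw [e2, mul_pow]
  nlinarith [sq_nonneg (eta p d n)]

/-- Comparison with `∑_S b_S ω_S` through the explicit harmonic polynomial `swapAvg`: its distance
to the harmonic projection on the slice equals its distance to the function itself, and damping
the homogeneous parts of the harmonic difference does not increase the norm. -/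
theorem abs_sqrt_wsum_levelMul_sub_le_of_few {a : Finset (Fin n) → ℝ} (ha : HarmCoeff a)
    (hev : ∀ A, #A = k → ev a A = fourierFun p b A)
    {c : ℕ → ℝ} (hc0 : ∀ i, 0 ≤ c i) (hc1 : ∀ i, c i ≤ 1) :
    |√(wsum (sliceW n k) fun A => ev (levelMul c a) A ^ 2) - √(∑ S, levelMul c b S ^ 2)| ≤
      9 * eta p d n := by
  have hη := eta_nonneg p d n
  -- `swapAvg` maps level `i` to degree `i`, so damping commutes with it, and the estimates for `b`
  -- apply to `levelMul c b` as well.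
  have hb' : ∀ S, ¬ S ⊆ D → levelMul c b S = 0 := fun S hS => by
    rw [levelMul, hb S hS, mul_zero]
  have h1' : ∑ S, levelMul c b S ^ 2 ≤ 1 := by
    refine (sum_le_sum fun S _ => ?_).trans h1
    rw [levelMul, mul_pow]
    exact mul_le_of_le_one_left (sq_nonneg _) (pow_le_one₀ (hc0 _) (hc1 _))
  have hdd : d ≤ d ^ 2 := Nat.le_self_pow two_ne_zero d
  obtain ⟨τ, hτ⟩ := exists_isSwapFamily (m := k / d + 1) D (by
    have h2 : k / d * #D ≤ k := (Nat.mul_le_mul_left _ hD).trans (Nat.div_mul_le_self k d)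
    rw [add_mul, one_mul]; omega)
  set H := sqfCoeff (swapAvg p D τ b) with hH
  have hHmul : ∀ b : Finset (Fin n) → ℝ, IsMultilinear (swapAvg p D τ b) :=
    fun b => hτ.isMultilinear_swapAvg b
  have hHh : HarmCoeff H := (isHarmonic_swapAvg b).harmCoeff (hHmul b)
  have hdiff : HarmCoeff fun S => a S - H S := fun R => by
    rw [sum_sub_distrib, ha R, hHh R, sub_zero]
  have s1 : |√(wsum (sliceW n k) fun A => ev (levelMul c a) A ^ 2) -
      √(wsum (sliceW n k) fun A => ev (levelMul c H) A ^ 2)| ≤ 4 * eta p d n := by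
    refine (abs_sqrt_wsum_sub_le sliceW_nonneg _ _).trans ?_
    refine le_trans ?_ (sqrt_wsum_sliceW_swapAvg_sub_le hn hp0 hp1 hkn hk hD hd hb h1 hτ)
    refine Real.sqrt_le_sqrt ?_
    have e1 : ∀ A, ev (levelMul c a) A - ev (levelMul c H) A =
        ev (levelMul c fun S => a S - H S) A := by
      intro A
      rw [← ev_sub]; congr 1; funext S; simp only [levelMul]; ring
    simp only [e1]
    refine (hdiff.wsum_ev_levelMul_sq_le k hc0 hc1).trans (le_of_eq ?_)
    refine wsum_sliceW_congr fun A hA => ?_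
    rw [ev_sub, hev A hA, (hHmul b).eval_ind]; ring
  have s2 : |√(wsum (sliceW n k) fun A => ev (levelMul c H) A ^ 2) -
      √(wsum (sliceW n k) fun A => fourierFun p (levelMul c b) A ^ 2)| ≤ 4 * eta p d n := by
    refine (abs_sqrt_wsum_sub_le sliceW_nonneg _ _).trans ?_
    refine le_trans (le_of_eq ?_)
      (sqrt_wsum_sliceW_swapAvg_sub_le hn hp0 hp1 hkn hk hD hd hb' h1' hτ)
    simp only [(hHmul _).eval_ind, sqfCoeff_swapAvg_levelMul, hH]
  have s3 : |√(wsum (sliceW n k) fun A => fourierFun p (levelMul c b) A ^ 2) -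
      √(∑ S, levelMul c b S ^ 2)| ≤ eta p d n := by
    refine (abs_sqrt_sub_sqrt_le (wsum_nonneg sliceW_nonneg fun A => sq_nonneg _)
      (sum_nonneg fun S _ => sq_nonneg _)).trans ?_
    refine Real.sqrt_le_iff.2 ⟨hη, ?_⟩
    exact (abs_wsum_sliceW_fourierFun_sq_sub_le hn hp0 hp1 hkn hk hD hd hb' h1').trans
      (sq_div_le_eta_sq hp0 hkn)
  rw [abs_le] at *
  constructor <;> linarith [s1.1, s1.2, s2.1, s2.2, s3.1, s3.2]

end few

section all
variable (hn : 0 < k) (hp0 : 0 < p) (hp1 : p < 1) (hkn : (k : ℝ) = p * n) (hk : 2 * k ≤ n)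
  (hD : #D ≤ d) (hd : d ≤ k) (hb : ∀ S, ¬ S ⊆ D → b S = 0) (h1 : ∑ S, b S ^ 2 ≤ 1)
include hn hp0 hp1 hkn hk hD hd hb h1

theorem wsum_sliceW_fourierFun_sq_le :
    (wsum (sliceW n k) fun A => fourierFun p b A ^ 2) ≤ 2 + errorTerm d n := by
  have h := wsum_slice_le_cube (F := fun A => fourierFun p b A ^ 2) (by omega) hkn hp0.le hp1.le hk
    hD hd (fun A => by rw [fourierFun_inter hb]) (fun A => sq_nonneg _)
  rw [wsum_cubeW_fourierFun_sq hp0 hp1] at h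
  have := errorTerm_nonneg d n
  exact h.trans (mul_le_of_le_one_right (by linarith) h1)

/-- The comparison for arbitrary `d ≤ k`. When `9 d² > k` both norms are bounded by a constant plus
the error term, and `1 ≤ 3 η`. -/
theorem abs_wsum_levelMul_sub_le {a : Finset (Fin n) → ℝ} (ha : HarmCoeff a)
    (hev : ∀ A, #A = k → ev a A = fourierFun p b A)
    {c : ℕ → ℝ} (hc0 : ∀ i, 0 ≤ c i) (hc1 : ∀ i, c i ≤ 1) :
    |√(wsum (sliceW n k) fun A => ev (levelMul c a) A ^ 2) - √(∑ S, levelMul c b S ^ 2)| ≤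
      30 * eta p d n ∧
    |(wsum (sliceW n k) fun A => ev (levelMul c a) A ^ 2) - ∑ S, levelMul c b S ^ 2| ≤
      30 * eta p d n := by
  have hη := eta_nonneg p d n
  have hX0 : 0 ≤ wsum (sliceW n k) fun A => ev (levelMul c a) A ^ 2 :=
    wsum_nonneg sliceW_nonneg fun A => sq_nonneg _
  have hY0 : 0 ≤ ∑ S, levelMul c b S ^ 2 := sum_nonneg fun S _ => sq_nonneg _
  have hY1 : ∑ S, levelMul c b S ^ 2 ≤ 1 := by
    refine (sum_le_sum fun S _ => ?_).trans h1
    rw [levelMul, mul_pow]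
    exact mul_le_of_le_one_left (sq_nonneg _) (pow_le_one₀ (hc0 _) (hc1 _))
  have hXf : (wsum (sliceW n k) fun A => ev (levelMul c a) A ^ 2) ≤
      wsum (sliceW n k) fun A => fourierFun p b A ^ 2 := by
    refine (ha.wsum_ev_levelMul_sq_le k hc0 hc1).trans (le_of_eq ?_)
    exact wsum_sliceW_congr fun A hA => by rw [hev A hA]
  have hx := Real.sq_sqrt hX0
  have hy := Real.sq_sqrt hY0
  have hx0 := Real.sqrt_nonneg (wsum (sliceW n k) fun A => ev (levelMul c a) A ^ 2)
  have hy0 := Real.sqrt_nonneg (∑ S, levelMul c b S ^ 2)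
  rcases le_or_gt (9 * d ^ 2) k with hd9 | hd9
  · have h2 := abs_sqrt_wsum_levelMul_sub_le_of_few hn hp0 hp1 hkn hk hD hd9 hb h1 ha hev hc0 hc1
    have h3 := (wsum_sliceW_fourierFun_sq_le_of_few hn hp0 hp1 hkn hk hD hd9 hb h1).1
    refine ⟨h2.trans (by linarith), ?_⟩
    set x := √(wsum (sliceW n k) fun A => ev (levelMul c a) A ^ 2)
    set y := √(∑ S, levelMul c b S ^ 2)
    have hx2 : x ≤ 2 := by nlinarith
    have hy1 : y ≤ 1 := by nlinarith
    rw [← hx, ← hy, show x ^ 2 - y ^ 2 = (x - y) * (x + y) by ring, abs_mul,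
      abs_of_nonneg (add_nonneg hx0 hy0)]
    calc |x - y| * (x + y) ≤ 9 * eta p d n * 3 :=
          mul_le_mul h2 (by linarith) (by linarith) (by positivity)
      _ ≤ _ := by linarith
  · have h3 := one_le_three_mul_eta hn hp0 hkn hd9
    have h4 := wsum_sliceW_fourierFun_sq_le hn hp0 hp1 hkn hk hD hd hb h1
    have h5 := errorTerm_le_eta (d := d) (n := n) hp0 hp1.le
    set x := √(wsum (sliceW n k) fun A => ev (levelMul c a) A ^ 2)
    set y := √(∑ S, levelMul c b S ^ 2)
    have hy1 : y ≤ 1 := by nlinarith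
    have hx1 : x ≤ 1 + x ^ 2 := by nlinarith [sq_nonneg (x - 1)]
    rw [abs_le, abs_le]
    refine ⟨⟨?_, ?_⟩, ?_, ?_⟩ <;> linarith

/-- The comparison of means and variances for arbitrary `d ≤ k`. -/
theorem abs_mean_sub_le :
    |wsum (sliceW n k) (fourierFun p b) - b ∅| ≤ 30 * eta p d n ∧
    |((wsum (sliceW n k) fun A => fourierFun p b A ^ 2) -
        wsum (sliceW n k) (fourierFun p b) ^ 2) - (∑ S, b S ^ 2 - b ∅ ^ 2)| ≤
      30 * eta p d n := by
  have hη := eta_nonneg p d n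
  have hbe : b ∅ ^ 2 ≤ ∑ S, b S ^ 2 :=
    single_le_sum (f := fun S => b S ^ 2) (fun S _ => sq_nonneg _) (mem_univ ∅)
  have hcs := wsum_sliceW_sq_le (by omega : k ≤ n) (fourierFun p b)
  have hb1 : |b ∅| ≤ 1 := by
    rw [← sq_le_one_iff_abs_le_one]; linarith
  set x := wsum (sliceW n k) (fourierFun p b)
  rcases le_or_gt (9 * d ^ 2) k with hd9 | hd9
  · obtain ⟨-, h2, h3⟩ := wsum_sliceW_fourierFun_sq_le_of_few hn hp0 hp1 hkn hk hD hd9 hb h1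
    have h4 := abs_wsum_sliceW_fourierFun_sub_le hn hp0 hp1 hkn hk hD hd9 hb h1
    have h5 := abs_wsum_sliceW_fourierFun_sq_sub_le hn hp0 hp1 hkn hk hD hd9 hb h1
    refine ⟨h4.trans (by linarith), ?_⟩
    have h6 : |x ^ 2 - b ∅ ^ 2| ≤ 3 * eta p d n := by
      rw [show x ^ 2 - b ∅ ^ 2 = (x - b ∅) * (x + b ∅) by ring, abs_mul, mul_comm]
      refine mul_le_mul ?_ (h4.trans h3) (abs_nonneg _) (by norm_num)
      have h7 := h4.trans h2
      rw [abs_le] at *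
      constructor <;> linarith [h7.1, h7.2, hb1.1, hb1.2]
    rw [abs_le] at *
    constructor <;> linarith [h5.1, h5.2, h6.1, h6.2]
  · have h3 := one_le_three_mul_eta hn hp0 hkn hd9
    have h4 := wsum_sliceW_fourierFun_sq_le hn hp0 hp1 hkn hk hD hd hb h1
    have h5 := errorTerm_le_eta (d := d) (n := n) hp0 hp1.le
    have hx : |x| ≤ 1 + x ^ 2 := by nlinarith [sq_nonneg (|x| - 1), sq_abs x, abs_nonneg x]
    have hx' := abs_le.1 hx
    have hb' := abs_le.1 hb1
    refine ⟨abs_le.2 ⟨?_, ?_⟩, abs_le.2 ⟨?_, ?_⟩⟩ <;>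
      linarith [hx'.1, hx'.2, hb'.1, hb'.2, sq_nonneg x, sq_nonneg (b ∅)]

end all

end final

end HarmonicSlice

open HarmonicSlice

theorem mainTheorem10 :
    ∃ A N : ℝ → ℝ,
      ContinuousOn A (Set.Ioc 0 (1 / 2)) ∧ ContinuousOn N (Set.Ioc 0 (1 / 2)) ∧
      ∀ (p : ℝ) (n k d : ℕ), 0 < p → (k : ℝ) = p * n → d ≤ k → p ≤ 1 / 2 → N p ≤ n →
      ∀ f : MvPolynomial (Fin n) ℝ,
        HarmonicSlice.IsMultilinear f → f.vars.card ≤ d →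
        HarmonicSlice.l2norm (HarmonicSlice.cubeMeasure n p) f ≤ 1 →
        (∃! g, HarmonicSlice.IsHarmonicProjection k f g) ∧
        ∀ g, HarmonicSlice.IsHarmonicProjection k f g →
        ∀ π, π = HarmonicSlice.cubeMeasure n p ∨ π = HarmonicSlice.gaussMeasure n p →
          |HarmonicSlice.expect π f - HarmonicSlice.expect (HarmonicSlice.sliceMeasure n k) g|
              ≤ A p * HarmonicSlice.errorTerm d n ∧
          |HarmonicSlice.l2norm (HarmonicSlice.sliceMeasure n k) g - HarmonicSlice.l2norm π f|
              ≤ A p * HarmonicSlice.errorTerm d n ∧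
          |HarmonicSlice.var (HarmonicSlice.sliceMeasure n k) g - HarmonicSlice.var π f|
              ≤ A p * HarmonicSlice.errorTerm d n ∧
          (∀ ρ ∈ Set.Icc (0 : ℝ) 1,
            |HarmonicSlice.sliceNoiseStab k ρ g - HarmonicSlice.noiseStab π p ρ f|
              ≤ A p * HarmonicSlice.errorTerm d n) ∧
          (∀ l ≤ d,
            |HarmonicSlice.l2norm (HarmonicSlice.sliceMeasure n k)
                (MvPolynomial.homogeneousComponent l g)
              - HarmonicSlice.l2norm π (HarmonicSlice.levelPart p l f)|
              ≤ A p * HarmonicSlice.errorTerm d n) := by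
  refine ⟨fun p => 30 / √p, fun _ => 1, ?_, continuousOn_const, ?_⟩
  · exact continuousOn_const.div Real.continuous_sqrt.continuousOn
      fun p hp => (Real.sqrt_pos.2 hp.1).ne'
  intro p n k d hp0 hkn hdk hp2 hN f hf hvars hnorm
  have hp1 : p < 1 := by linarith
  have hk' : (0 : ℝ) < k := by rw [hkn]; exact mul_pos hp0 (by linarith)
  have hn : 0 < k := by exact_mod_cast hk'
  have hk : 2 * k ≤ n := by
    have : (2 : ℝ) * k ≤ n := by
      rw [hkn]; nlinarith
    exact_mod_cast this
  refine ⟨existsUnique_isHarmonicProjection hk f, fun g hg π hπ => ?_⟩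
  obtain ⟨b, hb, hbdeg, hfb⟩ := hf.exists_fourier_expansion hp0 hp1
  obtain ⟨m, hm, rfl⟩ : ∃ m, IsNormalisedBy p m ∧
      π = MeasureTheory.Measure.pi fun _ : Fin n => m := by
    rcases hπ with rfl | rfl
    · exact ⟨_, isNormalisedBy_bernoulli hp0 hp1, rfl⟩
    · exact ⟨_, isNormalisedBy_gaussian hp0 hp1, rfl⟩
  have h1 : ∑ S, b S ^ 2 ≤ 1 := by
    rw [hfb] at hnorm
    have h := (isNormalisedBy_bernoulli hp0 hp1).l2norm_eq b
    rw [cubeMeasure, h] at hnorm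
    exact Real.sqrt_le_one.1 hnorm
  have hA : 30 / √p * errorTerm d n = 30 * eta p d n := by rw [eta]; ring
  have ha : HarmCoeff (sqfCoeff g) := hg.harmonic.harmCoeff hg.multilinear
  have hfun : ∀ A, MvPolynomial.eval (ind A) f = fourierFun p b A := by
    intro A; conv_lhs => rw [hfb]
    exact eval_sum_character b _
  have hev : ∀ A : Finset (Fin n), A.card = k → ev (sqfCoeff g) A = fourierFun p b A := by
    intro A hA
    rw [← hg.multilinear.eval_ind, hg.agrees _ (ind_mem_slice hA), hfun]
  have hmean := abs_mean_sub_le hn hp0 hp1 hkn hk hvars hdk hb h1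
  have hlev := fun (c : ℕ → ℝ) (hc0 : ∀ i, 0 ≤ c i) (hc1 : ∀ i, c i ≤ 1) =>
    abs_wsum_levelMul_sub_le hn hp0 hp1 hkn hk hvars hdk hb h1 ha hev hc0 hc1
  have hone := hlev (fun _ => 1) (fun _ => zero_le_one) (fun _ => le_rfl)
  simp only [levelMul_one] at hone
  have hsq : (wsum (sliceW n k) fun A => ev (sqfCoeff g) A ^ 2) =
      wsum (sliceW n k) fun A => fourierFun p b A ^ 2 :=
    wsum_sliceW_congr fun A hA => by rw [hev A hA]
  have hmn : wsum (sliceW n k) (ev (sqfCoeff g)) = wsum (sliceW n k) (fourierFun p b) :=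
    wsum_sliceW_congr hev
  simp only [hA]
  refine ⟨?_, ?_, ?_, ?_, ?_⟩
  · rw [abs_sub_comm, expect_sliceMeasure]
    simp only [hg.multilinear.eval_ind]
    rw [hmn, hfb, hm.expect_eq]
    exact hmean.1
  · rw [l2norm_sliceMeasure]
    simp only [hg.multilinear.eval_ind]
    rw [hfb, hm.l2norm_eq]
    exact hone.1
  · rw [var_sliceMeasure (by omega)]
    simp only [hg.multilinear.eval_ind]
    rw [hsq, hmn, hfb, hm.var_eq]
    exact hmean.2
  · intro ρ hρ
    -- The noise stability at `ρ` is the squared norm after damping degree `i` by `√ρ ^ i`.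
    have h := (hlev (fun i => √ρ ^ i) (fun i => by positivity)
      (fun i => pow_le_one₀ (Real.sqrt_nonneg _) (Real.sqrt_le_one.2 hρ.2))).2
    have hpow : ∀ i : ℕ, √ρ ^ i * √ρ ^ i = ρ ^ i := fun i => by
      rw [← mul_pow, Real.mul_self_sqrt hρ.1]
    have e1 : sliceNoiseStab k ρ g = wsum (sliceW n k) fun A =>
        ev (levelMul (fun i => √ρ ^ i) (sqfCoeff g)) A ^ 2 := by
      have h2 := ha.wsum_ev_levelMul_mul k (fun _ => 1) (fun i => ρ ^ i)
      have h3 := ha.wsum_ev_levelMul_mul k (fun i => √ρ ^ i) (fun i => √ρ ^ i)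
      simp only [levelMul_one, one_mul] at h2
      simp only [hpow, ← sq] at h3
      rw [sliceNoiseStab, expect_sliceMeasure, h3, ← h2]
      simp only [map_mul, hg.multilinear.eval_ind,
        (isMultilinear_sliceNoiseOp hg.multilinear ρ).eval_ind, sqfCoeff_sliceNoiseOp]
    have e2 : noiseStab (MeasureTheory.Measure.pi fun _ : Fin n => m) p ρ f =
        ∑ S, levelMul (fun i => √ρ ^ i) b S ^ 2 := by
      rw [hfb] at hbdeg ⊢
      rw [hm.noiseStab_eq hp0 hp1 hbdeg]
      refine Finset.sum_congr rfl fun S _ => ?_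
      rw [levelMul, mul_pow, sq (√ρ ^ _), hpow]
    rw [e1, e2]
    exact h
  · intro l _
    have h := (hlev (fun j => if j = l then 1 else 0) (fun i => by split_ifs <;> norm_num)
      (fun i => by split_ifs <;> norm_num)).1
    rw [l2norm_sliceMeasure]
    simp only [(hg.multilinear.homogeneousComponent l).eval_ind,
      sqfCoeff_homogeneousComponent]
    rw [hfb, levelPart_sum hp0 hp1, hm.l2norm_eq]
    exact h
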